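/- Let $\mathrm{sign}(t)=1$ for $t\ge 0$ and $\mathrm{sign}(t)=-1$ for $t<0$ (applied entrywise to vectors), let $\lambda=\sqrt{2/\pi}$, and let $\|\cdot\|_2$ be the spectral norm of matrices. For positive integers $d_1,d_2,k$ let $\mathcal F_k\subset\mathbb R^{d_1\times d_2}$ be the set of matrices of rank at most $k$ all of whose columns have Euclidean norm $1$. Let $(\mathbf x_i,\bar{\mathbf e}_i)$, $i=1,\dots,m$, be i.i.d. random pairs such that $\mathbf x_i$ is a standard Gaussian vector in $\mathbb R^{d_1}$, $\bar{\mathbf e}_i=\sqrt{d_2}\,\mathbf e_{j_i}$ where $j_i$ is uniformly distributed on $\{1,\dots,d_2\}$ and $\mathbf e_1,\dots,\mathbf e_{d_2}$ is the standard basis of $\mathbb R^{d_2}$, and $\mathbf x_i$ and $\bar{\mathbf e}_i$ are independent. Define $\mathcal A:\mathbb R^{d_1\times d_2}\to\mathbb R^m$ by $\mathcal A(W)=(\langle \mathbf x_i\bar{\mathbf e}_i^\top,W\rangle)_{i=1}^m$, with the entrywise matrix inner product, and let $\mathcal A'(\mathbf y)=\sum_{i=1}^m y_i\,\mathbf x_i\bar{\mathbf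 e}_i^\top$ be its adjoint. **Theorem.** For every $\eta\in(0,1)$ and every constant $C'>0$ there is a constant $C>0$, depending only on $\eta$ and $C'$, such that the following holds. Let $d_1>d_2$, let $W,W'\in\mathcal F_k$ be fixed with $W\neq W'$, let $\delta>0$, let $m\ge C\,d_1d_2k^{1/2}/\delta^2$, and put $\delta'=\delta/(C' d_1^{1/2}k^{1/2})$. Then, with probability at least $1-\eta$, $$\Big\|\frac{\sqrt{d_2}}{\lambda m}\Big(\mathcal A'(\mathrm{sign}(\mathcal A(W)))-\mathcal A'(\mathrm{sign}(\mathcal A(W')))\Big)-(W-W')\Big\|_2\le\delta\,\max\big\{\|W-W'\|_2,\ \|W-W'\|_2^{1/2},\ \delta'\big\}.$$ In particular, for given $m$ one may take $\delta=\sqrt{C\,d_1d_2k^{1/2}/m}$. -/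

import Mathlib

open MeasureTheory ProbabilityTheory
-- On matrices, `‖·‖` is the spectral norm (the operator norm between Euclidean spaces).
open scoped Matrix.Norms.L2Operator

namespace OneBitSensing

/-- The signum function with the convention `sign 0 = 1`. -/
noncomputable def sign (t : ℝ) : ℝ := if 0 ≤ t then 1 else -1

/-- The matrix inner product `⟨A, B⟩ = ∑ A_{ab} B_{ab}`. -/
def inner {d₁ d₂ : ℕ} (A B : Matrix (Fin d₁) (Fin d₂) ℝ) : ℝ :=
  ∑ a, ∑ b, A a b * B a b

/-- The matrices of rank at most `k` all of whose columns have Euclidean norm one. -/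
def normalizedRankLE (d₁ d₂ k : ℕ) : Set (Matrix (Fin d₁) (Fin d₂) ℝ) :=
  {W | W.rank ≤ k ∧ ∀ j, ‖WithLp.toLp 2 (fun a => W a j)‖ = 1}

/-- The scaled one-hot vector `√d₂ • e_j`. -/
noncomputable def scaledOneHot {d₂ : ℕ} (j : Fin d₂) : Fin d₂ → ℝ :=
  √(d₂ : ℝ) • Pi.single j 1

/-- The rank-one sensing matrix `x ēᵀ`, where `ē = √d₂ • e_j`. -/
noncomputable def sensingMatrix {d₁ d₂ : ℕ} (x : Fin d₁ → ℝ) (j : Fin d₂) :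
    Matrix (Fin d₁) (Fin d₂) ℝ :=
  Matrix.vecMulVec x (scaledOneHot j)

/-- The sensing operator `𝒜(W) = (⟨x_i ē_iᵀ, W⟩)_i`. -/
noncomputable def sensing {d₁ d₂ m : ℕ} (x : Fin m → Fin d₁ → ℝ) (j : Fin m → Fin d₂)
    (W : Matrix (Fin d₁) (Fin d₂) ℝ) : Fin m → ℝ :=
  fun i => inner (sensingMatrix (x i) (j i)) W

/-- The adjoint operator `𝒜'(y) = ∑ y_i x_i ē_iᵀ`. -/
noncomputable def sensingAdjoint {d₁ d₂ m : ℕ} (x : Fin m → Fin d₁ → ℝ) (j : Fin m → Fin d₂)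
    (y : Fin m → ℝ) : Matrix (Fin d₁) (Fin d₂) ℝ :=
  ∑ i, y i • sensingMatrix (x i) (j i)

/-- `sensingAdjoint` is the adjoint of `sensing`. -/
theorem inner_sensingAdjoint {d₁ d₂ m : ℕ} (x : Fin m → Fin d₁ → ℝ) (j : Fin m → Fin d₂)
    (y : Fin m → ℝ) (W : Matrix (Fin d₁) (Fin d₂) ℝ) :
    inner (sensingAdjoint x j y) W = ∑ i, y i * sensing x j W i := by
  simp only [inner, sensingAdjoint, sensing, Matrix.sum_apply, Matrix.smul_apply, smul_eq_mul,
    Finset.sum_mul, Finset.mul_sum]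
  calc _ = ∑ a, ∑ i, ∑ b, y i * sensingMatrix (x i) (j i) a b * W a b :=
        Finset.sum_congr rfl fun a _ => Finset.sum_comm
    _ = ∑ i, ∑ a, ∑ b, y i * sensingMatrix (x i) (j i) a b * W a b := Finset.sum_comm
    _ = _ := by simp only [mul_assoc]

/-- The random model: the `m` pairs `(x_i, j_i)` are independent; in each of them `x_i` is a
standard Gaussian vector of `ℝ^{d₁}`, `j_i` (the position of the one in the one-hot vector) is
uniformly distributed, and `x_i`, `j_i` are independent. -/
structure IsSample {Ω : Type*} [MeasurableSpace Ω] (P : Measure Ω) {d₁ d₂ m : ℕ}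
    (x : Fin m → Ω → Fin d₁ → ℝ) (j : Fin m → Ω → Fin d₂) : Prop where
  law_x : ∀ i, HasLaw (x i) (Measure.pi fun _ => gaussianReal 0 1) P
  law_j : ∀ i, HasLaw (j i) (uniformOn Set.univ) P
  indep_pair : ∀ i, IndepFun (x i) (j i) P
  indep : iIndepFun (fun i ω => (x i ω, j i ω)) P

end OneBitSensing

/-! Up to the factor `d₂ / (λ m)`, the matrix to be bounded is a centred sum `A = ∑ (Bᵢ - β)` of
i.i.d. matrices `Bᵢ = yᵢ xᵢ eᵀ`, with `e` the basis vector of index `jᵢ`, `yᵢ` the difference of the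
two one-bit measurements, and mean `β = (λ / d₂)(W - W')`. As `W` and `W'` are fixed, no net is
needed: Markov's inequality for a polynomial majorant of `‖A‖⁴` suffices.

The majorant comes from `‖A‖² = ‖AᵀA‖`. The diagonal products `BᵢᵀBᵢ` sum to a diagonal matrix,
whose norm is a maximum of column sums of `yᵢ²|xᵢ|²`; its square is controlled by the largest single
term and by products over distinct pairs. The centred off-diagonal products form a degenerate
U-statistic, so most of its correlations vanish. By `integral_sum_sq_gram_offDiag_le` its expected
squared Frobenius norm is at most `2m²` times that of a `d₁ × d₁` covariance matrix, which
directional second moments control.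

Smallness comes from a strip: if columns `w`, `w'` at a moderate angle separate `x`, the component
of `x` along `w` is at most twice an independent Gaussian quantity of size at most `|w - w'|`. Hence
moments weighted by `yᵢ²` are linear in the column distance (`integral_sq_sign_sub_sign_mul_le`).

Together, with `d₂ < d₁`, this gives `E‖A‖⁴ ≤ K d₁² (1 + (m/d₂)² ‖W - W'‖_F²)`
(`exists_integral_deviationBound_le`), and the rank bound gives `‖W - W'‖_F² ≤ 2k ‖W - W'‖²`. In
`moment_le_of_sample_size` the first summand is absorbed by `δ'` and the second by `‖W - W'‖^{1/2}`;
the latter needs only `√k` in the sample size, because `(d₁√k)² = d₁²k`. -/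

namespace OneBitSensing

/-! ### Functions with moments of every order. -/

/-- All polynomial moments of `f` are finite. -/
def HasAllMoments {α : Type*} [MeasurableSpace α] (f : α → ℝ) (μ : Measure α) : Prop :=
  ∀ n : ℕ, MemLp f n μ

namespace HasAllMoments

variable {α : Type*} [MeasurableSpace α] {f g : α → ℝ} {μ : Measure α}

lemma memLp_two (hf : HasAllMoments f μ) : MemLp f 2 μ := by simpa using hf 2

lemma integrable (hf : HasAllMoments f μ) : Integrable f μ :=
  memLp_one_iff_integrable.1 (by simpa using hf 1)

lemma aestronglyMeasurable (hf : HasAllMoments f μ) : AEStronglyMeasurable f μ :=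
  (hf 1).aestronglyMeasurable

lemma add (hf : HasAllMoments f μ) (hg : HasAllMoments g μ) :
    HasAllMoments (fun x => f x + g x) μ := fun n => (hf n).add (hg n)

lemma sub (hf : HasAllMoments f μ) (hg : HasAllMoments g μ) :
    HasAllMoments (fun x => f x - g x) μ := fun n => (hf n).sub (hg n)

/-- Hölder with exponents `2n`, `2n`, `n`. Closure under products is the reason for requiring all
orders at once. -/
lemma mul (hf : HasAllMoments f μ) (hg : HasAllMoments g μ) :
    HasAllMoments (fun x => f x * g x) μ := fun n => by
  have : ENNReal.HolderTriple ((2 * n : ℕ) : ENNReal) ((2 * n : ℕ) : ENNReal) n := by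
    constructor
    rw [Nat.cast_mul, ENNReal.mul_inv (by simp) (by simp), ← add_mul]
    simp [ENNReal.inv_two_add_inv_two]
  exact (hg (2 * n)).mul' (hf (2 * n))

lemma of_bound [IsFiniteMeasure μ] (hf : AEStronglyMeasurable f μ) (C : ℝ) (h : ∀ x, |f x| ≤ C) :
    HasAllMoments f μ := fun _ => MemLp.of_bound hf C (Filter.Eventually.of_forall h)

lemma const [IsFiniteMeasure μ] (c : ℝ) : HasAllMoments (fun _ => c) μ := fun _ => memLp_const c

lemma pow [IsFiniteMeasure μ] (hf : HasAllMoments f μ) (n : ℕ) :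
    HasAllMoments (fun x => f x ^ n) μ := by
  induction n with
  | zero => simpa using const 1
  | succ n ih => simpa only [pow_succ] using ih.mul hf

lemma sum {ι : Type*} {s : Finset ι} {F : ι → α → ℝ} (h : ∀ i ∈ s, HasAllMoments (F i) μ) :
    HasAllMoments (fun x => ∑ i ∈ s, F i x) μ := fun n => memLp_finsetSum s fun i hi => h i hi n

lemma abs (hf : HasAllMoments f μ) : HasAllMoments (fun x => |f x|) μ := fun n => (hf n).abs

lemma comp_hasLaw {β : Type*} [MeasurableSpace β] {ν : Measure β} {X : β → α}
    (hf : HasAllMoments f μ) (hX : HasLaw X μ ν) : HasAllMoments (fun y => f (X y)) ν := fun n => by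
  have h := hf n
  rw [← hX.map_eq] at h
  exact h.comp_of_map hX.aemeasurable

end HasAllMoments

/-- The Cauchy-Schwarz inequality for integrals of products. -/
lemma integral_mul_le_sqrt_mul_sqrt {α : Type*} [MeasurableSpace α] {μ : Measure α} {f g : α → ℝ}
    (hf : MemLp f 2 μ) (hg : MemLp g 2 μ) :
    ∫ x, f x * g x ∂μ ≤ √(∫ x, f x ^ 2 ∂μ) * √(∫ x, g x ^ 2 ∂μ) := by
  have h := integral_mul_norm_le_Lp_mul_Lq (μ := μ) (f := f) (g := g)
    Real.HolderConjugate.two_two (by simpa using hf) (by simpa using hg)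
  calc ∫ x, f x * g x ∂μ ≤ ∫ x, ‖f x‖ * ‖g x‖ ∂μ := by
        refine integral_mono (hf.integrable_mul hg) (hf.norm.integrable_mul hg.norm) fun x => ?_
        simpa [← abs_mul] using le_abs_self (f x * g x)
    _ ≤ _ := by
        refine h.trans (le_of_eq ?_)
        simp [Real.sqrt_eq_rpow]

/-! ### Standard Gaussian vectors and their linear functionals. -/

/-- The standard Gaussian measure on `Fin d → ℝ`. -/
noncomputable abbrev gaussianPi (d : ℕ) : Measure (Fin d → ℝ) :=
  Measure.pi fun _ => gaussianReal 0 1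

lemma hasLaw_eval_gaussianPi {d : ℕ} (a : Fin d) :
    HasLaw (fun x : Fin d → ℝ => x a) (gaussianReal 0 1) (gaussianPi d) :=
  (measurePreserving_eval (fun _ : Fin d => gaussianReal 0 1) a).hasLaw

lemma iIndepFun_eval_gaussianPi (d : ℕ) :
    iIndepFun (fun (a : Fin d) (x : Fin d → ℝ) => x a) (gaussianPi d) :=
  (iIndepFun_iff_hasLaw_pi_pi hasLaw_eval_gaussianPi).2 HasLaw.id

lemma hasGaussianLaw_id_gaussianPi (d : ℕ) :
    HasGaussianLaw (fun x : Fin d → ℝ => x) (gaussianPi d) :=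
  (iIndepFun_eval_gaussianPi d).hasGaussianLaw fun a => (hasLaw_eval_gaussianPi a).hasGaussianLaw

lemma hasAllMoments_id_gaussianReal : HasAllMoments (fun t => t) (gaussianReal 0 1) := fun n =>
  memLp_id_gaussianReal' n (by simp)

lemma hasAllMoments_eval_gaussianPi {d : ℕ} (a : Fin d) :
    HasAllMoments (fun x : Fin d → ℝ => x a) (gaussianPi d) :=
  hasAllMoments_id_gaussianReal.comp_hasLaw (hasLaw_eval_gaussianPi a)

lemma hasAllMoments_dotProduct {d : ℕ} (u : Fin d → ℝ) :
    HasAllMoments (fun x => x ⬝ᵥ u) (gaussianPi d) :=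
  HasAllMoments.sum fun a _ => (hasAllMoments_eval_gaussianPi a).mul (.const (u a))

lemma hasAllMoments_dotProduct_self {d : ℕ} :
    HasAllMoments (fun x => x ⬝ᵥ x) (gaussianPi d) :=
  HasAllMoments.sum fun a _ => (hasAllMoments_eval_gaussianPi a).mul
    (hasAllMoments_eval_gaussianPi a)

lemma integral_eval_gaussianPi {d : ℕ} (a : Fin d) : ∫ x, x a ∂gaussianPi d = 0 := by
  rw [(hasLaw_eval_gaussianPi a).integral_eq, integral_id_gaussianReal]

lemma covariance_dotProduct {d : ℕ} (u v : Fin d → ℝ) :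
    cov[fun x => x ⬝ᵥ u, fun x => x ⬝ᵥ v; gaussianPi d] = u ⬝ᵥ v := by
  have h2 (c : ℝ) (a : Fin d) : MemLp (fun x : Fin d → ℝ => x a * c) 2 (gaussianPi d) :=
    ((hasAllMoments_eval_gaussianPi a).mul (.const c)).memLp_two
  simp only [dotProduct]
  rw [covariance_fun_sum_fun_sum (fun a => h2 _ a) (fun a => h2 _ a)]
  refine Finset.sum_congr rfl fun a _ => ?_
  simp only [covariance_mul_const_left, covariance_mul_const_right]
  rw [Finset.sum_eq_single a]
  · rw [covariance_self (hasLaw_eval_gaussianPi a).aemeasurable, (hasLaw_eval_gaussianPi a).variance_eq,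
      variance_id_gaussianReal]
    simp
  · intro b _ hb
    rw [((iIndepFun_eval_gaussianPi d).indepFun hb.symm).covariance_eq_zero
      (hasAllMoments_eval_gaussianPi a).memLp_two (hasAllMoments_eval_gaussianPi b).memLp_two]
    simp
  · simp

lemma hasLaw_dotProduct {d : ℕ} (u : Fin d → ℝ) :
    HasLaw (fun x => x ⬝ᵥ u) (gaussianReal 0 (u ⬝ᵥ u).toNNReal) (gaussianPi d) where
  aemeasurable := (hasAllMoments_dotProduct u).aestronglyMeasurable.aemeasurable
  map_eq := by
    let L : (Fin d → ℝ) →L[ℝ] ℝ := LinearMap.toContinuousLinearMap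
      { toFun := fun x => x ⬝ᵥ u, map_add' := by simp, map_smul' := by simp }
    have h : HasGaussianLaw (fun x => x ⬝ᵥ u) (gaussianPi d) :=
      (hasGaussianLaw_id_gaussianPi d).map_fun L
    rw [h.map_eq_gaussianReal, ← covariance_self h.aemeasurable, covariance_dotProduct]
    congr 1
    simp only [dotProduct]
    rw [integral_finsetSum _ fun a _ =>
      ((hasAllMoments_eval_gaussianPi a).mul (.const _)).integrable]
    simp [integral_mul_const, integral_eval_gaussianPi]

/-- The moments of a standard Gaussian variable. -/
noncomputable def gaussianMoment (n : ℕ) : ℝ := ∫ t, t ^ n ∂gaussianReal 0 1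

lemma integral_dotProduct_pow {d : ℕ} (u : Fin d → ℝ) (n : ℕ) :
    ∫ x, (x ⬝ᵥ u) ^ n ∂gaussianPi d = √(u ⬝ᵥ u) ^ n * gaussianMoment n := by
  have h0 : 0 ≤ u ⬝ᵥ u := dotProduct_self_star_nonneg u
  have h1 : (gaussianReal 0 1).map (fun t => √(u ⬝ᵥ u) * t)
      = gaussianReal 0 (u ⬝ᵥ u).toNNReal := by
    rw [gaussianReal_map_const_mul]
    congr 1
    · simp
    · ext
      simp [Real.sq_sqrt h0, h0]
  have h2 := (hasLaw_dotProduct u).integral_comp (f := fun t => t ^ n) (by fun_prop)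
  simp only [Function.comp_def] at h2
  rw [h2, ← h1, integral_map (by fun_prop) (by fun_prop), gaussianMoment, ← integral_const_mul]
  simp only [mul_pow]

lemma gaussianMoment_two : gaussianMoment 2 = 1 := by
  have := variance_id_gaussianReal (μ := 0) (v := 1)
  rw [variance_eq_integral (by fun_prop)] at this
  simpa [gaussianMoment, integral_id_gaussianReal] using this

/-- The component of a standard Gaussian vector along a unit vector is independent of the
orthogonal component. -/
lemma indepFun_dotProduct_sub {d : ℕ} {w : Fin d → ℝ} (hw : w ⬝ᵥ w = 1) :
    IndepFun (fun x => x ⬝ᵥ w) (fun x => x - (x ⬝ᵥ w) • w) (gaussianPi d) := by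
  let L : (Fin d → ℝ) →L[ℝ] (Unit → ℝ) × (Fin d → ℝ) := LinearMap.toContinuousLinearMap
      { toFun := fun x => (fun _ => x ⬝ᵥ w, fun a => (x - (x ⬝ᵥ w) • w) a)
        map_add' := fun x y => by ext <;> simp; ring
        map_smul' := fun c x => by ext <;> simp; ring }
  have h : HasGaussianLaw (fun x => ((fun _ => x ⬝ᵥ w : Unit → ℝ),
      fun a => (x - (x ⬝ᵥ w) • w) a)) (gaussianPi d) :=
    (hasGaussianLaw_id_gaussianPi d).map_fun L
  -- The pair is jointly Gaussian, so vanishing covariances give independence; the scalar component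
  -- is viewed as a family over `Unit`.
  have h' := h.indepFun_of_covariance_eval (X := fun _ x => x ⬝ᵥ w)
    (Y := fun a x => (x - (x ⬝ᵥ w) • w) a) fun _ a => by
    have : (fun x : Fin d → ℝ => (x - (x ⬝ᵥ w) • w) a)
        = fun x => x ⬝ᵥ (Pi.single a 1 - w a • w) := by
      ext x
      simp [mul_comm]
    rw [this, covariance_dotProduct]
    simp [hw]
  exact h'.comp (φ := fun f : Unit → ℝ => f ()) (ψ := id) (by fun_prop) measurable_id

/-! ### Moments of independent sums and of the squared norm. -/

/-- Second and fourth moments of sums of independent centred variables. -/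
lemma integral_sum_pow_four_le {Ω ι : Type*} [MeasurableSpace Ω] {P : Measure Ω}
    [IsProbabilityMeasure P] {X : ι → Ω → ℝ} (hX : ∀ i, HasAllMoments (X i) P)
    (hind : iIndepFun X P) (h1 : ∀ i, ∫ ω, X i ω ∂P = 0) {V M : ℝ}
    (h2 : ∀ i, ∫ ω, X i ω ^ 2 ∂P ≤ V) (h4 : ∀ i, ∫ ω, X i ω ^ 4 ∂P ≤ M) (hV : 0 ≤ V)
    (hVM : V ^ 2 ≤ M) (s : Finset ι) :
    ∫ ω, (∑ i ∈ s, X i ω) ^ 2 ∂P ≤ V * s.card ∧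
      ∫ ω, (∑ i ∈ s, X i ω) ^ 4 ∂P ≤ 3 * M * (s.card : ℝ) ^ 2 := by
  classical
  induction s using Finset.induction_on with
  | empty => simp
  | insert a s ha ih =>
    obtain ⟨ih2, ih4⟩ := ih
    set S : Ω → ℝ := fun ω => ∑ i ∈ s, X i ω with hS
    have mS : HasAllMoments S P := HasAllMoments.sum fun i _ => hX i
    have mX := hX a
    have hi : IndepFun (X a) S P := by
      have := (hind.indepFun_finsetSum_of_notMem₀
        (fun i => (hX i).aestronglyMeasurable.aemeasurable) ha).symm
      convert this using 1
      ext ω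
      simp [hS]
    have hprod (p q : ℕ) : ∫ ω, X a ω ^ p * S ω ^ q ∂P
        = (∫ ω, X a ω ^ p ∂P) * ∫ ω, S ω ^ q ∂P :=
      hi.integral_fun_comp_mul_comp (f := fun t => t ^ p) (g := fun t => t ^ q)
        mX.aestronglyMeasurable.aemeasurable mS.aestronglyMeasurable.aemeasurable
        (by fun_prop) (by fun_prop)
    have hint (p q : ℕ) (c : ℝ) : HasAllMoments (fun ω => c * (X a ω ^ p * S ω ^ q)) P :=
      (HasAllMoments.const c).mul ((mX.pow p).mul (mS.pow q))
    have hS1 : ∫ ω, S ω ^ 1 ∂P = 0 := by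
      simp only [pow_one, hS]
      rw [integral_finsetSum _ fun i _ => (hX i).integrable]
      simp [h1]
    have hX1 : ∫ ω, X a ω ^ 1 ∂P = 0 := by simpa using h1 a
    have e2 : ∫ ω, (∑ i ∈ insert a s, X i ω) ^ 2 ∂P
        = (∫ ω, X a ω ^ 2 ∂P) + ∫ ω, S ω ^ 2 ∂P := by
      have : ∀ ω, (∑ i ∈ insert a s, X i ω) ^ 2 = 1 * (X a ω ^ 2 * S ω ^ 0)
          + (2 * (X a ω ^ 1 * S ω ^ 1) + 1 * (X a ω ^ 0 * S ω ^ 2)) := fun ω => by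
        rw [Finset.sum_insert ha]; simp only [hS]; ring
      simp only [this]
      rw [integral_add (hint _ _ _).integrable ((hint _ _ _).add (hint _ _ _)).integrable,
        integral_add (hint _ _ _).integrable (hint _ _ _).integrable]
      simp only [integral_const_mul, hprod, hS1]
      simp
    have e4 : ∫ ω, (∑ i ∈ insert a s, X i ω) ^ 4 ∂P
        = (∫ ω, X a ω ^ 4 ∂P) + 6 * ((∫ ω, X a ω ^ 2 ∂P) * ∫ ω, S ω ^ 2 ∂P)
          + ∫ ω, S ω ^ 4 ∂P := by
      have : ∀ ω, (∑ i ∈ insert a s, X i ω) ^ 4 = 1 * (X a ω ^ 4 * S ω ^ 0)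
          + (4 * (X a ω ^ 3 * S ω ^ 1) + (6 * (X a ω ^ 2 * S ω ^ 2)
          + (4 * (X a ω ^ 1 * S ω ^ 3) + 1 * (X a ω ^ 0 * S ω ^ 4)))) := fun ω => by
        rw [Finset.sum_insert ha]; simp only [hS]; ring
      simp only [this]
      rw [integral_add (hint _ _ _).integrable
          ((hint _ _ _).add ((hint _ _ _).add ((hint _ _ _).add (hint _ _ _)))).integrable,
        integral_add (hint _ _ _).integrable
          ((hint _ _ _).add ((hint _ _ _).add (hint _ _ _))).integrable,
        integral_add (hint _ _ _).integrable ((hint _ _ _).add (hint _ _ _)).integrable,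
        integral_add (hint _ _ _).integrable (hint _ _ _).integrable]
      simp only [integral_const_mul, hprod, hS1, hX1]
      simp
      ring
    have hn : (0 : ℝ) ≤ s.card := Nat.cast_nonneg _
    have p2 : 0 ≤ ∫ ω, S ω ^ 2 ∂P := integral_nonneg fun ω => sq_nonneg _
    have hm : (∫ ω, X a ω ^ 2 ∂P) * ∫ ω, S ω ^ 2 ∂P ≤ V * (V * s.card) :=
      mul_le_mul (h2 a) ih2 p2 hV
    rw [e2, e4, Finset.card_insert_of_notMem ha]
    push_cast
    constructor
    · linarith [h2 a]
    -- The step is `M + 6 V² n + 3 M n² ≤ 3 M (n + 1)²`, using `V² ≤ M`.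
    · nlinarith [h4 a, mul_le_mul_of_nonneg_right hVM hn, sq_nonneg V]

/-- The squared norm of a standard Gaussian vector concentrates around the dimension. -/
lemma exists_integral_normSq_sub_pow_le : ∃ K : ℝ, 0 < K ∧ ∀ d : ℕ,
    ∫ x, (x ⬝ᵥ x - d) ^ 2 ∂gaussianPi d ≤ K * d ∧
      ∫ x, (x ⬝ᵥ x - d) ^ 4 ∂gaussianPi d ≤ K * (d : ℝ) ^ 2 := by
  set V : ℝ := ∫ t, (t ^ 2 - 1) ^ 2 ∂gaussianReal 0 1 with hV
  set M : ℝ := ∫ t, (t ^ 2 - 1) ^ 4 ∂gaussianReal 0 1 with hM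
  have hV0 : 0 ≤ V := integral_nonneg fun t => sq_nonneg _
  have hM0 : 0 ≤ M := integral_nonneg fun t => by positivity
  refine ⟨V + 3 * (M + V ^ 2) + 1, by positivity, fun d => ?_⟩
  have hlaw (f : ℝ → ℝ) (hf : Measurable f) (a : Fin d) :
      ∫ x : Fin d → ℝ, f (x a) ∂gaussianPi d = ∫ t, f t ∂gaussianReal 0 1 :=
    (hasLaw_eval_gaussianPi a).integral_comp hf.aestronglyMeasurable
  have mom (a : Fin d) : HasAllMoments (fun x : Fin d → ℝ => x a ^ 2 - 1) (gaussianPi d) :=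
    ((hasAllMoments_eval_gaussianPi a).pow 2).sub (.const 1)
  -- Taking `M + V ^ 2` as fourth-moment parameter makes its comparison with `V ^ 2` immediate,
  -- without Jensen.
  have key := integral_sum_pow_four_le (X := fun (a : Fin d) (x : Fin d → ℝ) => x a ^ 2 - 1)
    (V := V) (M := M + V ^ 2) mom
    ((iIndepFun_eval_gaussianPi d).comp (fun _ t => t ^ 2 - 1) fun _ => by fun_prop)
    (fun a => by
      rw [hlaw (fun t => t ^ 2 - 1) (by fun_prop) a,
        integral_sub (hasAllMoments_id_gaussianReal.pow 2).integrable (integrable_const _)]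
      simpa [sub_eq_zero, gaussianMoment] using gaussianMoment_two)
    (fun a => (hlaw (fun t => (t ^ 2 - 1) ^ 2) (by fun_prop) a).le)
    (fun a => (hlaw (fun t => (t ^ 2 - 1) ^ 4) (by fun_prop) a).le.trans (by nlinarith))
    hV0 (by linarith) Finset.univ
  have hs (x : Fin d → ℝ) : ∑ a, (x a ^ 2 - 1) = x ⬝ᵥ x - d := by
    simp [dotProduct, Finset.sum_sub_distrib, sq]
  simp only [hs, Finset.card_univ, Fintype.card_fin] at key
  refine ⟨key.1.trans ?_, key.2.trans ?_⟩
  · gcongr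
    nlinarith
  · gcongr
    nlinarith

/-! ### One-dimensional Gaussian estimates and signs. -/

/-- The density is at most `1 / 2`, because `√(2π) ≥ 2`, and the interval has length `2 s`. -/
lemma gaussianReal_abs_le_le {s : ℝ} (hs : 0 ≤ s) :
    (gaussianReal 0 1).real {t | |t| ≤ s} ≤ s := by
  have hset : {t : ℝ | |t| ≤ s} = Set.Icc (-s) s := by
    ext t; simp [abs_le]
  have h1 : √(2 * Real.pi) ≥ 2 := by
    apply Real.le_sqrt_of_sq_le
    nlinarith [Real.pi_gt_three]
  have hle : ∀ t, gaussianPDFReal 0 1 t ≤ 1 / 2 := fun t => by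
    rw [gaussianPDFReal]
    have : (√(2 * Real.pi * (1 : NNReal)))⁻¹ ≤ 1 / 2 := by
      simp only [NNReal.coe_one, mul_one]
      rw [one_div]
      exact inv_anti₀ (by norm_num) h1
    calc _ ≤ (1 / 2 : ℝ) * 1 := by
          refine mul_le_mul this ?_ (by positivity) (by norm_num)
          rw [Real.exp_le_one_iff]
          simp only [NNReal.coe_one]
          have := sq_nonneg (t - 0)
          rw [div_nonpos_iff]; right
          constructor <;> linarith
      _ = _ := by norm_num
  rw [measureReal_def, gaussianReal_apply_eq_integral 0 one_ne_zero, hset,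
    ENNReal.toReal_ofReal (integral_nonneg fun t => gaussianPDFReal_nonneg 0 1 t)]
  calc ∫ t in Set.Icc (-s) s, gaussianPDFReal 0 1 t
      ≤ ∫ _ in Set.Icc (-s) s, (1 / 2 : ℝ) :=
        integral_mono (integrable_gaussianPDFReal 0 1).integrableOn (by simp) hle
    _ = s := by
        rw [setIntegral_const, measureReal_def, Real.volume_Icc, ENNReal.toReal_ofReal (by linarith)]
        simp
        ring

lemma integral_abs_gaussianReal : ∫ t, |t| ∂gaussianReal 0 1 = √(2 / Real.pi) := by
  rw [integral_gaussianReal_eq_integral_smul one_ne_zero]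
  have h : ∀ t : ℝ, gaussianPDFReal 0 1 t • |t|
      = (fun s : ℝ => (√(2 * Real.pi))⁻¹ * (s * Real.exp (-(1 / 2) * s ^ 2))) |t| := fun t => by
    simp only [gaussianPDFReal, smul_eq_mul, sq_abs, NNReal.coe_one, mul_one, sub_zero]
    rw [show -t ^ 2 / 2 = -(1 / 2) * t ^ 2 by ring]
    ring
  simp only [h]
  rw [integral_comp_abs (f := fun s : ℝ => (√(2 * Real.pi))⁻¹ * (s * Real.exp (-(1 / 2) * s ^ 2))),
    integral_const_mul]
  have h2 : ∫ s in Set.Ioi (0 : ℝ), s * Real.exp (-(1 / 2) * s ^ 2) = 1 := by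
    have := integral_mul_cexp_neg_mul_sq (b := 1 / 2) (by norm_num)
    have h3 : ((∫ s in Set.Ioi (0 : ℝ), s * Real.exp (-(1 / 2) * s ^ 2) : ℝ) : ℂ) = 1 := by
      rw [← integral_complex_ofReal]
      push_cast
      rw [this]
      norm_num
    exact_mod_cast h3
  rw [h2, mul_one, Real.sqrt_div' _ Real.pi_pos.le, Real.sqrt_mul (by norm_num)]
  have e2 : √2 * √2 = (2 : ℝ) := Real.mul_self_sqrt (by norm_num)
  have : √Real.pi ≠ 0 := (Real.sqrt_pos.2 Real.pi_pos).ne'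
  have : √(2 : ℝ) ≠ 0 := by positivity
  field_simp
  nlinarith

lemma measurable_sign : Measurable sign :=
  Measurable.ite measurableSet_Ici measurable_const measurable_const

lemma sign_mul_self (t : ℝ) : sign t * t = |t| := by
  unfold sign
  split_ifs with h
  · rw [abs_of_nonneg h, one_mul]
  · rw [abs_of_neg (not_le.1 h)]; ring

lemma abs_sign (t : ℝ) : |sign t| = 1 := by
  unfold sign; split_ifs <;> simp

lemma sq_sign_sub_sign_le (s t : ℝ) : (sign s - sign t) ^ 2 ≤ 4 := by
  unfold sign; split_ifs <;> norm_num

/-- The difference takes only the values `0` and `±2`. Trading its fourth power for a square returns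
to the weight handled by the strip estimate. -/
lemma sign_sub_sign_pow_four (s t : ℝ) : (sign s - sign t) ^ 4 = 4 * (sign s - sign t) ^ 2 := by
  unfold sign; split_ifs <;> norm_num

lemma mul_nonpos_of_sign_sub_sign_ne_zero {s t : ℝ} (h : sign s - sign t ≠ 0) : s * t ≤ 0 := by
  unfold sign at h
  split_ifs at h with h1 h2 h2
  · simp at h
  · nlinarith
  · nlinarith
  · simp at h

/-- The correlation of a Gaussian vector with the sign of one of its components. -/
lemma integral_sign_mul_eval {d : ℕ} {w : Fin d → ℝ} (hw : w ⬝ᵥ w = 1) (a : Fin d) :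
    ∫ x, sign (x ⬝ᵥ w) * x a ∂gaussianPi d = √(2 / Real.pi) * w a := by
  -- The part of `x` along `w` contributes `w a` times the mean of `|x ⬝ᵥ w|`, which is `λ`; the
  -- orthogonal part is centred and independent of the sign.
  have hsplit (x : Fin d → ℝ) : sign (x ⬝ᵥ w) * x a
      = w a * |x ⬝ᵥ w| + sign (x ⬝ᵥ w) * (x - (x ⬝ᵥ w) • w) a := by
    rw [← sign_mul_self]
    simp
    ring
  have hs : HasAllMoments (fun x : Fin d → ℝ => sign (x ⬝ᵥ w)) (gaussianPi d) :=
    .of_bound (measurable_sign.comp (by fun_prop)).aestronglyMeasurable 1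
      fun x => (abs_sign _).le
  have hy : HasAllMoments (fun x : Fin d → ℝ => (x - (x ⬝ᵥ w) • w) a) (gaussianPi d) :=
    (hasAllMoments_eval_gaussianPi a).sub ((hasAllMoments_dotProduct w).mul (.const (w a)))
  have hlaw : HasLaw (fun x => x ⬝ᵥ w) (gaussianReal 0 1) (gaussianPi d) := by
    simpa [hw] using hasLaw_dotProduct w
  have h0 : ∫ x : Fin d → ℝ, (x - (x ⬝ᵥ w) • w) a ∂gaussianPi d = 0 := by
    simp only [Pi.sub_apply, Pi.smul_apply, smul_eq_mul]
    rw [integral_sub (hasAllMoments_eval_gaussianPi a).integrable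
      ((hasAllMoments_dotProduct w).mul (.const (w a))).integrable, integral_mul_const,
      hlaw.integral_eq, integral_id_gaussianReal, integral_eval_gaussianPi]
    simp
  simp only [hsplit]
  rw [integral_add ((HasAllMoments.const _).mul (hasAllMoments_dotProduct w).abs).integrable
    (hs.mul hy).integrable, integral_const_mul]
  have h1 : ∫ x, |x ⬝ᵥ w| ∂gaussianPi d = √(2 / Real.pi) := by
    rw [← integral_abs_gaussianReal]
    exact hlaw.integral_comp (f := fun t => |t|) (by fun_prop)
  have h2 := (indepFun_dotProduct_sub hw).integral_fun_comp_mul_comp (f := sign)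
    (g := fun y => y a) (by fun_prop) (by fun_prop) measurable_sign.aestronglyMeasurable
    (measurable_pi_apply a).aestronglyMeasurable
  rw [h1, h2, h0]
  ring

/-! ### Moments over the region where two sign measurements disagree. -/

/-- A strip bound: if `g` is a standard Gaussian variable independent of `Y`, integrating out `g`
over `|g| ≤ f Y` costs at most a factor `f Y`. -/
lemma integral_indicator_abs_le {Ω β : Type*} [MeasurableSpace Ω] [MeasurableSpace β]
    {P : Measure Ω} [IsProbabilityMeasure P] {g : Ω → ℝ} {Y : Ω → β}
    (hg : HasLaw g (gaussianReal 0 1) P) (hY : AEMeasurable Y P) (hind : IndepFun g Y P)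
    {f F : β → ℝ} (hf : Measurable f) (hF : Measurable F) (hf0 : ∀ y, 0 ≤ f y)
    (hF0 : ∀ y, 0 ≤ F y) (iF : Integrable (fun ω => F (Y ω)) P)
    (ifF : Integrable (fun ω => f (Y ω) * F (Y ω)) P) :
    Integrable (fun ω => {ω | |g ω| ≤ f (Y ω)}.indicator (fun ω => F (Y ω)) ω) P ∧
    ∫ ω, {ω | |g ω| ≤ f (Y ω)}.indicator (fun ω => F (Y ω)) ω ∂P
      ≤ ∫ ω, f (Y ω) * F (Y ω) ∂P := by
  set ν := P.map Y
  have : IsProbabilityMeasure ν := Measure.isProbabilityMeasure_map hY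
  have hYl : HasLaw Y ν P := ⟨hY, rfl⟩
  have hpair := hind.hasLaw_prod hg hYl
  set G : ℝ × β → ℝ := {p | |p.1| ≤ f p.2}.indicator fun p => F p.2 with hG
  have hset : MeasurableSet {p : ℝ × β | |p.1| ≤ f p.2} :=
    measurableSet_le (by fun_prop) (by fun_prop)
  have mG : Measurable G := (hF.comp measurable_snd).indicator hset
  have iFν : Integrable F ν := by
    rw [integrable_map_measure hF.aestronglyMeasurable hY]; exact iF
  have ifFν : Integrable (fun y => f y * F y) ν := by
    refine (integrable_map_measure (hf.mul hF).aestronglyMeasurable hY).2 ?_; exact ifF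
  have iG : Integrable G ((gaussianReal 0 1).prod ν) :=
    (iFν.comp_snd (gaussianReal 0 1)).indicator hset
  have e : ∀ ω, {ω | |g ω| ≤ f (Y ω)}.indicator (fun ω => F (Y ω)) ω = G (g ω, Y ω) := fun ω => by
    simp [hG, Set.indicator]
  simp only [e]
  constructor
  · have := (integrable_map_measure (f := fun ω => (g ω, Y ω)) (μ := P) (g := G)
      mG.aestronglyMeasurable hpair.aemeasurable).1 (by rw [hpair.map_eq]; exact iG)
    exact this
  have e1 : ∫ ω, G (g ω, Y ω) ∂P = ∫ p, G p ∂((gaussianReal 0 1).prod ν) :=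
    hpair.integral_comp mG.aestronglyMeasurable
  have e2 : ∫ ω, f (Y ω) * F (Y ω) ∂P = ∫ y, f y * F y ∂ν :=
    hYl.integral_comp (f := fun y => f y * F y) (hf.mul hF).aestronglyMeasurable
  rw [e1, e2, integral_prod_symm _ iG]
  refine integral_mono iG.integral_prod_right ifFν fun y => ?_
  have : ∀ t, G (t, y) = {t : ℝ | |t| ≤ f y}.indicator (fun _ => F y) t := fun t => by
    simp [hG, Set.indicator]
  simp only [this]
  rw [integral_indicator_const _ (measurableSet_le (by fun_prop) (by fun_prop))]
  exact mul_le_mul_of_nonneg_right (gaussianReal_abs_le_le (hf0 y)) (hF0 y)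

lemma dotProduct_self_nonneg_real {d : ℕ} (u : Fin d → ℝ) : 0 ≤ u ⬝ᵥ u :=
  Finset.sum_nonneg fun a _ => mul_self_nonneg (u a)

lemma sub_smul_dotProduct {d : ℕ} (x w u : Fin d → ℝ) :
    (x - (x ⬝ᵥ w) • w) ⬝ᵥ u = x ⬝ᵥ (u - (w ⬝ᵥ u) • w) := by
  simp [sub_dotProduct, dotProduct_sub, mul_comm]

lemma sub_smul_dotProduct_self {d : ℕ} {w : Fin d → ℝ} (hw : w ⬝ᵥ w = 1) (x : Fin d → ℝ) :
    (x - (x ⬝ᵥ w) • w) ⬝ᵥ (x - (x ⬝ᵥ w) • w) = x ⬝ᵥ x - (x ⬝ᵥ w) ^ 2 := by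
  simp only [sub_dotProduct, dotProduct_sub, smul_dotProduct, dotProduct_smul, hw, smul_eq_mul,
    dotProduct_comm w x]
  ring

lemma measurable_sign_sub_sign {d : ℕ} (w w' : Fin d → ℝ) :
    Measurable fun x : Fin d → ℝ => sign (x ⬝ᵥ w) - sign (x ⬝ᵥ w') :=
  (measurable_sign.comp (by fun_prop)).sub (measurable_sign.comp (by fun_prop))

lemma hasAllMoments_sign_sub_sign {d : ℕ} (w w' : Fin d → ℝ) :
    HasAllMoments (fun x : Fin d → ℝ => sign (x ⬝ᵥ w) - sign (x ⬝ᵥ w')) (gaussianPi d) :=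
  .of_bound (measurable_sign_sub_sign w w').aestronglyMeasurable 2 fun x =>
    abs_le_of_sq_le_sq (by nlinarith [sq_sign_sub_sign_le (x ⬝ᵥ w) (x ⬝ᵥ w')]) (by norm_num)

/-- If two unit vectors with `w ⬝ᵥ w' ≥ 1 / 2` separate `x`, then `x` lies in a thin strip. -/
lemma abs_dotProduct_le_of_sign_ne {d : ℕ} {w w' x : Fin d → ℝ} (hw : w ⬝ᵥ w = 1)
    (hc : 1 / 2 ≤ w ⬝ᵥ w') (h : sign (x ⬝ᵥ w) - sign (x ⬝ᵥ w') ≠ 0) :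
    |x ⬝ᵥ w| ≤ 2 * |(x - (x ⬝ᵥ w) • w) ⬝ᵥ (w' - (w ⬝ᵥ w') • w)| := by
  have hm := mul_nonpos_of_sign_sub_sign_ne_zero h
  have e : (x - (x ⬝ᵥ w) • w) ⬝ᵥ (w' - (w ⬝ᵥ w') • w) = x ⬝ᵥ w' - (w ⬝ᵥ w') * (x ⬝ᵥ w) := by
    simp only [sub_dotProduct, dotProduct_sub, smul_dotProduct, dotProduct_smul, hw, smul_eq_mul]
    ring
  rw [e]
  generalize x ⬝ᵥ w = g at *
  generalize x ⬝ᵥ w' = g' at *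
  generalize w ⬝ᵥ w' = c at *
  rcases eq_or_lt_of_le (abs_nonneg g) with h0 | h0
  · rw [← h0]; positivity
  -- After multiplication by `|g|`: `g g' ≤ 0` and `c ≥ 1 / 2` give `|g| |g' - c g| ≥ c g² - g g' ≥
  -- g² / 2`.
  · refine le_of_mul_le_mul_left ?_ h0
    have h1 : -(g * (g' - c * g)) ≤ |g| * |g' - c * g| := by
      rw [← abs_mul]; exact neg_le_abs _
    nlinarith [abs_mul_abs_self g, mul_self_nonneg g]

/-- Integrals over the set where two unit vectors have different signs are small when the two
vectors are close. -/
lemma integral_sq_sign_sub_sign_mul_le {d : ℕ} {w w' : Fin d → ℝ} (hw : w ⬝ᵥ w = 1)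
    (hw' : w' ⬝ᵥ w' = 1) {Φ F : (Fin d → ℝ) → ℝ} (hΦ : HasAllMoments Φ (gaussianPi d))
    (hΦ0 : ∀ x, 0 ≤ Φ x) (mF : Measurable F) (hF0 : ∀ y, 0 ≤ F y)
    (hF : HasAllMoments (fun x => F (x - (x ⬝ᵥ w) • w)) (gaussianPi d))
    (hΦF : ∀ x, |x ⬝ᵥ w| ≤ 2 * |(x - (x ⬝ᵥ w) • w) ⬝ᵥ (w' - (w ⬝ᵥ w') • w)| →
      Φ x ≤ F (x - (x ⬝ᵥ w) • w))
    {K : ℝ} (hK1 : ∫ x, Φ x ∂gaussianPi d ≤ K)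
    (hK2 : √(∫ x, F (x - (x ⬝ᵥ w) • w) ^ 2 ∂gaussianPi d) ≤ K) :
    ∫ x, (sign (x ⬝ᵥ w) - sign (x ⬝ᵥ w')) ^ 2 * Φ x ∂gaussianPi d
      ≤ 8 * K * √((w - w') ⬝ᵥ (w - w')) := by
  have hK0 : 0 ≤ K := (Real.sqrt_nonneg _).trans hK2
  have hz : (w - w') ⬝ᵥ (w - w') = 2 - 2 * (w ⬝ᵥ w') := by
    simp only [sub_dotProduct, dotProduct_sub, hw, hw', dotProduct_comm w' w]
    ring
  have iL : Integrable (fun x => (sign (x ⬝ᵥ w) - sign (x ⬝ᵥ w')) ^ 2 * Φ x) (gaussianPi d) :=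
    (((hasAllMoments_sign_sub_sign w w').pow 2).mul hΦ).integrable
  -- At a large angle the distance is at least one and the trivial bound on the weight suffices; the
  -- strip is needed only at a small angle.
  rcases lt_or_ge (w ⬝ᵥ w') (1 / 2) with hc | hc
  · have h1 : 1 ≤ √((w - w') ⬝ᵥ (w - w')) := by
      rw [hz]
      exact Real.le_sqrt_of_sq_le (by linarith)
    calc _ ≤ ∫ x, 4 * Φ x ∂gaussianPi d :=
          integral_mono iL (hΦ.integrable.const_mul 4) fun x =>
            mul_le_mul_of_nonneg_right (sq_sign_sub_sign_le _ _) (hΦ0 x)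
      _ ≤ 4 * K := by rw [integral_const_mul]; linarith
      _ ≤ _ := by nlinarith
  · set r := w' - (w ⬝ᵥ w') • w with hr
    set Y : (Fin d → ℝ) → (Fin d → ℝ) := fun x => x - (x ⬝ᵥ w) • w with hY
    have hwr : w ⬝ᵥ r = 0 := by simp [hr, dotProduct_sub, hw]
    have hYr (x : Fin d → ℝ) : Y x ⬝ᵥ r = x ⬝ᵥ r := by
      rw [hY, sub_smul_dotProduct, hwr]; simp
    have hrr : r ⬝ᵥ r ≤ (w - w') ⬝ᵥ (w - w') := by
      have : r ⬝ᵥ r = 1 - (w ⬝ᵥ w') ^ 2 := by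
        simp only [hr, sub_dotProduct, dotProduct_sub, smul_dotProduct, dotProduct_smul, hw, hw',
          smul_eq_mul, dotProduct_comm w' w]
        ring
      rw [hz, this]
      nlinarith [sq_nonneg (1 - w ⬝ᵥ w')]
    have hlaw : HasLaw (fun x => x ⬝ᵥ w) (gaussianReal 0 1) (gaussianPi d) := by
      simpa [hw] using hasLaw_dotProduct w
    have mf : HasAllMoments (fun x => 2 * |Y x ⬝ᵥ r|) (gaussianPi d) := by
      simp only [hYr]
      exact (HasAllMoments.const 2).mul (hasAllMoments_dotProduct r).abs
    obtain ⟨i1, h1⟩ := integral_indicator_abs_le hlaw (by fun_prop : AEMeasurable Y _)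
      (indepFun_dotProduct_sub hw) (f := fun y => 2 * |y ⬝ᵥ r|) (F := F) (by fun_prop) mF
      (fun y => by positivity) hF0 hF.integrable (mf.mul hF).integrable
    have hrn : √(∫ x, (2 * |Y x ⬝ᵥ r|) ^ 2 ∂gaussianPi d) = 2 * √(r ⬝ᵥ r) := by
      simp only [hYr, mul_pow, sq_abs]
      rw [integral_const_mul, integral_dotProduct_pow, gaussianMoment_two, mul_one,
        show (2 : ℝ) ^ 2 * √(r ⬝ᵥ r) ^ 2 = (2 * √(r ⬝ᵥ r)) ^ 2 by ring,
        Real.sqrt_sq (by positivity)]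
    calc _ ≤ ∫ x, 4 * {x | |x ⬝ᵥ w| ≤ 2 * |Y x ⬝ᵥ r|}.indicator (fun x => F (Y x)) x
            ∂gaussianPi d := by
          refine integral_mono iL (i1.const_mul 4) fun x => ?_
          by_cases hx : sign (x ⬝ᵥ w) - sign (x ⬝ᵥ w') = 0
          · simp only [hx]
            have : 0 ≤ {x | |x ⬝ᵥ w| ≤ 2 * |Y x ⬝ᵥ r|}.indicator (fun x => F (Y x)) x :=
              Set.indicator_nonneg (fun x _ => hF0 _) x
            simpa using this
          · have hx' := abs_dotProduct_le_of_sign_ne hw hc hx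
            have hmem : x ∈ {x | |x ⬝ᵥ w| ≤ 2 * |Y x ⬝ᵥ r|} := hx'
            simp only [Set.indicator_of_mem hmem]
            exact mul_le_mul (sq_sign_sub_sign_le _ _) (hΦF x hx') (hΦ0 x) (by norm_num)
      _ ≤ 4 * ∫ x, 2 * |Y x ⬝ᵥ r| * F (Y x) ∂gaussianPi d := by
          rw [integral_const_mul]; linarith
      _ ≤ 4 * (2 * √(r ⬝ᵥ r) * K) := by
          refine mul_le_mul_of_nonneg_left ?_ (by norm_num)
          -- Cauchy-Schwarz splits off the strip width, of `L²` norm `2 |r| ≤ 2 |w - w'|`; this is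
          -- where linearity in the distance arises.
          refine (integral_mul_le_sqrt_mul_sqrt mf.memLp_two hF.memLp_two).trans ?_
          rw [hrn]
          gcongr
      _ ≤ 4 * (2 * √((w - w') ⬝ᵥ (w - w')) * K) := by gcongr
      _ = _ := by ring

lemma sub_smul_dotProduct_self_comm {d : ℕ} {w : Fin d → ℝ} (hw : w ⬝ᵥ w = 1) (u : Fin d → ℝ) :
    (u - (w ⬝ᵥ u) • w) ⬝ᵥ (u - (w ⬝ᵥ u) • w) = u ⬝ᵥ u - (w ⬝ᵥ u) ^ 2 := by
  rw [dotProduct_comm w u]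
  exact sub_smul_dotProduct_self hw u

lemma gaussianMoment_even_nonneg (n : ℕ) : 0 ≤ gaussianMoment (2 * n) :=
  integral_nonneg fun t => by rw [pow_mul]; positivity

/-- Second moments of linear functionals on the set where two unit vectors have different
signs. -/
lemma exists_integral_sq_sign_sub_sign_mul_sq_le : ∃ K : ℝ, 0 < K ∧
    ∀ (d : ℕ) (w w' u : Fin d → ℝ), w ⬝ᵥ w = 1 → w' ⬝ᵥ w' = 1 →
      ∫ x, (sign (x ⬝ᵥ w) - sign (x ⬝ᵥ w')) ^ 2 * (x ⬝ᵥ u) ^ 2 ∂gaussianPi d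
        ≤ K * √((w - w') ⬝ᵥ (w - w')) * (u ⬝ᵥ u) := by
  have hM4 : 0 ≤ gaussianMoment 4 := gaussianMoment_even_nonneg 2
  refine ⟨8 * (√(136 * gaussianMoment 4) + 1), by positivity, fun d w w' u hw hw' => ?_⟩
  set r := w' - (w ⬝ᵥ w') • w with hr
  have hwr : w ⬝ᵥ r = 0 := by simp [hr, dotProduct_sub, hw]
  have hrr : r ⬝ᵥ r ≤ 1 := by
    rw [hr, sub_smul_dotProduct_self_comm hw, hw']; nlinarith [sq_nonneg (w ⬝ᵥ w')]
  have hr0 := dotProduct_self_nonneg_real r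
  set u' := u - (w ⬝ᵥ u) • w with hu'
  have huu : u' ⬝ᵥ u' = u ⬝ᵥ u - (w ⬝ᵥ u) ^ 2 := sub_smul_dotProduct_self_comm hw u
  have hu'0 := dotProduct_self_nonneg_real u'
  have hu0 := dotProduct_self_nonneg_real u
  set α := w ⬝ᵥ u with hα
  have hYr (x : Fin d → ℝ) : (x - (x ⬝ᵥ w) • w) ⬝ᵥ r = x ⬝ᵥ r := by
    rw [sub_smul_dotProduct, hwr]; simp
  have hYu (x : Fin d → ℝ) : (x - (x ⬝ᵥ w) • w) ⬝ᵥ u = x ⬝ᵥ u' := sub_smul_dotProduct x w u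
  have mr := hasAllMoments_dotProduct r
  have mu := hasAllMoments_dotProduct u'
  -- With `g = x ⬝ᵥ w` and `Y = x - g • w` one has `x ⬝ᵥ u = Y ⬝ᵥ u + α g`, and `g² ≤ 4 (Y ⬝ᵥ r)²`
  -- on the strip; doubling the squares gives `F`. Squaring `F` the same way yields `136 = 128 + 8`.
  refine (integral_sq_sign_sub_sign_mul_le hw hw' (Φ := fun x => (x ⬝ᵥ u) ^ 2)
    (F := fun y => 8 * α ^ 2 * (y ⬝ᵥ r) ^ 2 + 2 * (y ⬝ᵥ u) ^ 2)
    (K := (√(136 * gaussianMoment 4) + 1) * (u ⬝ᵥ u))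
    ((hasAllMoments_dotProduct u).pow 2) (fun x => sq_nonneg _) (by fun_prop)
    (fun y => by positivity) ?_ (fun x hx => ?_) ?_ ?_).trans (le_of_eq (by ring))
  · simp only [hYr, hYu]
    exact ((HasAllMoments.const _).mul (mr.pow 2)).add ((HasAllMoments.const _).mul (mu.pow 2))
  · have hxu : x ⬝ᵥ u = (x - (x ⬝ᵥ w) • w) ⬝ᵥ u + α * (x ⬝ᵥ w) := by
      simp [sub_dotProduct, hα, mul_comm]
    have h2 : (x ⬝ᵥ w) ^ 2 ≤ 4 * ((x - (x ⬝ᵥ w) • w) ⬝ᵥ r) ^ 2 := by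
      have := pow_le_pow_left₀ (abs_nonneg _) hx 2
      rw [sq_abs, mul_pow, sq_abs] at this
      linarith
    rw [hxu]
    nlinarith [mul_le_mul_of_nonneg_left h2 (sq_nonneg α),
      sq_nonneg ((x - (x ⬝ᵥ w) • w) ⬝ᵥ u - α * (x ⬝ᵥ w))]
  · rw [integral_dotProduct_pow, gaussianMoment_two, Real.sq_sqrt hu0]
    nlinarith [Real.sqrt_nonneg (136 * gaussianMoment 4)]
  · have hle : ∫ x, (8 * α ^ 2 * ((x - (x ⬝ᵥ w) • w) ⬝ᵥ r) ^ 2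
        + 2 * ((x - (x ⬝ᵥ w) • w) ⬝ᵥ u) ^ 2) ^ 2 ∂gaussianPi d
        ≤ 136 * gaussianMoment 4 * (u ⬝ᵥ u) ^ 2 := by
      simp only [hYr, hYu]
      have m1 : HasAllMoments (fun x => 128 * α ^ 4 * (x ⬝ᵥ r) ^ 4) (gaussianPi d) :=
        (HasAllMoments.const _).mul (mr.pow 4)
      have m2 : HasAllMoments (fun x => 8 * (x ⬝ᵥ u') ^ 4) (gaussianPi d) :=
        (HasAllMoments.const _).mul (mu.pow 4)
      have m0 := ((HasAllMoments.const (8 * α ^ 2)).mul (mr.pow 2)).add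
        ((HasAllMoments.const 2).mul (mu.pow 2))
      calc _ ≤ ∫ x, 128 * α ^ 4 * (x ⬝ᵥ r) ^ 4 + 8 * (x ⬝ᵥ u') ^ 4 ∂gaussianPi d := by
            refine integral_mono (m0.pow 2).integrable (m1.add m2).integrable fun x => ?_
            nlinarith [sq_nonneg (8 * α ^ 2 * (x ⬝ᵥ r) ^ 2 - 2 * (x ⬝ᵥ u') ^ 2)]
        _ = 128 * α ^ 4 * ((r ⬝ᵥ r) ^ 2 * gaussianMoment 4)
            + 8 * ((u' ⬝ᵥ u') ^ 2 * gaussianMoment 4) := by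
            rw [integral_add m1.integrable m2.integrable, integral_const_mul, integral_const_mul,
              integral_dotProduct_pow, integral_dotProduct_pow,
              show √(r ⬝ᵥ r) ^ 4 = (√(r ⬝ᵥ r) ^ 2) ^ 2 by ring,
              show √(u' ⬝ᵥ u') ^ 4 = (√(u' ⬝ᵥ u') ^ 2) ^ 2 by ring,
              Real.sq_sqrt hr0, Real.sq_sqrt hu'0]
        _ ≤ 128 * (u ⬝ᵥ u) ^ 2 * (1 ^ 2 * gaussianMoment 4)
            + 8 * ((u ⬝ᵥ u) ^ 2 * gaussianMoment 4) := by
            have : α ^ 4 ≤ (u ⬝ᵥ u) ^ 2 := by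
              rw [show α ^ 4 = (α ^ 2) ^ 2 by ring]
              gcongr
              linarith
            have : u' ⬝ᵥ u' ≤ u ⬝ᵥ u := by nlinarith [sq_nonneg α]
            gcongr
        _ = _ := by ring
    calc _ ≤ √(136 * gaussianMoment 4 * (u ⬝ᵥ u) ^ 2) := Real.sqrt_le_sqrt hle
      _ = √(136 * gaussianMoment 4) * (u ⬝ᵥ u) := by
          rw [Real.sqrt_mul (by positivity), Real.sqrt_sq hu0]
      _ ≤ _ := by nlinarith

/-- Fluctuations of the squared norm on the set where two unit vectors have different signs. -/
lemma exists_integral_sq_sign_sub_sign_mul_normSq_sub_sq_le : ∃ K : ℝ, 0 < K ∧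
    ∀ (d : ℕ) (w w' : Fin d → ℝ), w ⬝ᵥ w = 1 → w' ⬝ᵥ w' = 1 →
      ∫ x, (sign (x ⬝ᵥ w) - sign (x ⬝ᵥ w')) ^ 2 * (x ⬝ᵥ x - d) ^ 2 ∂gaussianPi d
        ≤ K * d * √((w - w') ⬝ᵥ (w - w')) := by
  obtain ⟨Q, hQ, hQd⟩ := exists_integral_normSq_sub_pow_le
  have hM8 : 0 ≤ gaussianMoment 8 := gaussianMoment_even_nonneg 4
  refine ⟨8 * (√(2112 * gaussianMoment 8 + 64 * Q) + Q), by positivity, fun d w w' hw hw' => ?_⟩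
  have hd : (1 : ℝ) ≤ d := by
    rcases d.eq_zero_or_pos with rfl | h
    · simp [dotProduct] at hw
    · exact_mod_cast h
  obtain ⟨hQ2, hQ4⟩ := hQd d
  set r := w' - (w ⬝ᵥ w') • w with hr
  have hwr : w ⬝ᵥ r = 0 := by simp [hr, dotProduct_sub, hw]
  have hrr : r ⬝ᵥ r ≤ 1 := by
    rw [hr, sub_smul_dotProduct_self_comm hw, hw']; nlinarith [sq_nonneg (w ⬝ᵥ w')]
  have hr0 := dotProduct_self_nonneg_real r
  have hYr (x : Fin d → ℝ) : (x - (x ⬝ᵥ w) • w) ⬝ᵥ r = x ⬝ᵥ r := by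
    rw [sub_smul_dotProduct, hwr]; simp
  have hYY := sub_smul_dotProduct_self hw
  have mr := hasAllMoments_dotProduct r
  have mw := hasAllMoments_dotProduct w
  have mN : HasAllMoments (fun x => x ⬝ᵥ x - (d : ℝ)) (gaussianPi d) :=
    hasAllMoments_dotProduct_self.sub (.const _)
  have mN' : HasAllMoments (fun x => x ⬝ᵥ x - (x ⬝ᵥ w) ^ 2 - (d : ℝ)) (gaussianPi d) :=
    (hasAllMoments_dotProduct_self.sub (mw.pow 2)).sub (.const _)
  -- Here `x ⬝ᵥ x - d = (Y ⬝ᵥ Y - d) + g²` with `Y = x - g • w`, `g = x ⬝ᵥ w`, and `g⁴ ≤ 16 (Y ⬝ᵥ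
  -- r)⁴` on the strip, whence `F`. In the constant, `2112 = 2048 + 64`; the moment terms free of
  -- `d` are absorbed using `d ≥ 1`.
  refine (integral_sq_sign_sub_sign_mul_le hw hw' (Φ := fun x => (x ⬝ᵥ x - d) ^ 2)
    (F := fun y => 32 * (y ⬝ᵥ r) ^ 4 + 2 * (y ⬝ᵥ y - d) ^ 2)
    (K := (√(2112 * gaussianMoment 8 + 64 * Q) + Q) * d)
    (mN.pow 2) (fun x => sq_nonneg _) (by fun_prop)
    (fun y => by positivity) ?_ (fun x hx => ?_) ?_ ?_).trans (le_of_eq (by ring))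
  · simp only [hYr, hYY]
    exact ((HasAllMoments.const _).mul (mr.pow 4)).add ((HasAllMoments.const _).mul (mN'.pow 2))
  · have h2 : (x ⬝ᵥ w) ^ 2 ≤ 4 * ((x - (x ⬝ᵥ w) • w) ⬝ᵥ r) ^ 2 := by
      have := pow_le_pow_left₀ (abs_nonneg _) hx 2
      rw [sq_abs, mul_pow, sq_abs] at this
      linarith
    have h4 : (x ⬝ᵥ w) ^ 4 ≤ 16 * ((x - (x ⬝ᵥ w) • w) ⬝ᵥ r) ^ 4 := by
      have := pow_le_pow_left₀ (sq_nonneg _) h2 2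
      nlinarith
    simp only [hYY]
    nlinarith [sq_nonneg (x ⬝ᵥ x - (x ⬝ᵥ w) ^ 2 - d - (x ⬝ᵥ w) ^ 2)]
  · refine hQ2.trans ?_
    gcongr
    linarith [Real.sqrt_nonneg (2112 * gaussianMoment 8 + 64 * Q)]
  · have hle : ∫ x, (32 * ((x - (x ⬝ᵥ w) • w) ⬝ᵥ r) ^ 4
        + 2 * ((x - (x ⬝ᵥ w) • w) ⬝ᵥ (x - (x ⬝ᵥ w) • w) - d) ^ 2) ^ 2 ∂gaussianPi d
        ≤ (2112 * gaussianMoment 8 + 64 * Q) * (d : ℝ) ^ 2 := by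
      simp only [hYr, hYY]
      have m1 : HasAllMoments (fun x => 2048 * (x ⬝ᵥ r) ^ 8) (gaussianPi d) :=
        (HasAllMoments.const _).mul (mr.pow 8)
      have m2 : HasAllMoments (fun x => 64 * (x ⬝ᵥ w) ^ 8) (gaussianPi d) :=
        (HasAllMoments.const _).mul (mw.pow 8)
      have m3 : HasAllMoments (fun x => 64 * (x ⬝ᵥ x - d) ^ 4) (gaussianPi d) :=
        (HasAllMoments.const _).mul (mN.pow 4)
      have m0 := ((HasAllMoments.const 32).mul (mr.pow 4)).add
        ((HasAllMoments.const 2).mul (mN'.pow 2))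
      calc _ ≤ ∫ x, 2048 * (x ⬝ᵥ r) ^ 8 + 64 * (x ⬝ᵥ w) ^ 8 + 64 * (x ⬝ᵥ x - d) ^ 4
              ∂gaussianPi d := by
            refine integral_mono (m0.pow 2).integrable ((m1.add m2).add m3).integrable fun x => ?_
            have ha (p q : ℝ) : (32 * p ^ 4 + 2 * q ^ 2) ^ 2 ≤ 2048 * p ^ 8 + 8 * q ^ 4 := by
              nlinarith [sq_nonneg (32 * p ^ 4 - 2 * q ^ 2)]
            have hb (p q : ℝ) : (p - q ^ 2) ^ 4 ≤ 8 * p ^ 4 + 8 * q ^ 8 := by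
              have h1 : (p - q ^ 2) ^ 2 ≤ 2 * p ^ 2 + 2 * q ^ 4 := by
                nlinarith [sq_nonneg (p + q ^ 2)]
              have h2 := pow_le_pow_left₀ (sq_nonneg _) h1 2
              nlinarith [sq_nonneg (2 * p ^ 2 - 2 * q ^ 4)]
            have h1 := ha (x ⬝ᵥ r) (x ⬝ᵥ x - (x ⬝ᵥ w) ^ 2 - d)
            have h2 := hb (x ⬝ᵥ x - d) (x ⬝ᵥ w)
            rw [show x ⬝ᵥ x - d - (x ⬝ᵥ w) ^ 2 = x ⬝ᵥ x - (x ⬝ᵥ w) ^ 2 - d by ring] at h2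
            simp only
            linarith
        _ = 2048 * ((r ⬝ᵥ r) ^ 4 * gaussianMoment 8) + 64 * gaussianMoment 8
            + 64 * ∫ x, (x ⬝ᵥ x - d) ^ 4 ∂gaussianPi d := by
            rw [integral_add (m1.add m2).integrable m3.integrable,
              integral_add m1.integrable m2.integrable, integral_const_mul, integral_const_mul,
              integral_const_mul, integral_dotProduct_pow, integral_dotProduct_pow,
              show √(r ⬝ᵥ r) ^ 8 = (√(r ⬝ᵥ r) ^ 2) ^ 4 by ring, Real.sq_sqrt hr0, hw]
            simp
        _ ≤ 2048 * (1 ^ 4 * gaussianMoment 8) + 64 * gaussianMoment 8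
            + 64 * (Q * (d : ℝ) ^ 2) := by gcongr
        _ ≤ _ := by
            have : 1 ≤ (d : ℝ) ^ 2 := one_le_pow₀ hd
            nlinarith
    calc _ ≤ √((2112 * gaussianMoment 8 + 64 * Q) * (d : ℝ) ^ 2) := Real.sqrt_le_sqrt hle
      _ = √(2112 * gaussianMoment 8 + 64 * Q) * d := by
          rw [Real.sqrt_mul (by positivity), Real.sqrt_sq (by positivity)]
      _ ≤ _ := by nlinarith

/-! ### Degenerate U-statistics of order two. -/

section UStatistic

variable {Ω S : Type*} [MeasurableSpace Ω] [MeasurableSpace S] {P : Measure Ω}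
  [IsProbabilityMeasure P] {μ : Measure S} {m : ℕ} {ξ : Fin m → Ω → S}

lemma hasLaw_pair (hlaw : ∀ i, HasLaw (ξ i) μ P) (hind : iIndepFun ξ P) {i i' : Fin m}
    (h : i ≠ i') : HasLaw (fun ω => (ξ i ω, ξ i' ω)) (μ.prod μ) P :=
  (hind.indepFun h).hasLaw_prod (hlaw i) (hlaw i')

variable [IsProbabilityMeasure μ]

/-- The variable of index `i` enters only through the first argument of `h`. With all the others
gathered in `T` and held fixed, the integral over it vanishes by degeneracy. -/
lemma integral_kernel_mul_eq_zero (hlaw : ∀ i, HasLaw (ξ i) μ P) (hind : iIndepFun ξ P)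
    {h k : S × S → ℝ} (mh : Measurable h) (mk : Measurable k)
    (h2 : MemLp h 2 (μ.prod μ)) (k2 : MemLp k 2 (μ.prod μ))
    (hdeg : ∀ t, ∫ s, h (s, t) ∂μ = 0) {i i' l l' : Fin m} (hi : i ≠ i') (hl : l ≠ l')
    (h1 : i ≠ l) (h1' : i ≠ l') :
    ∫ ω, h (ξ i ω, ξ i' ω) * k (ξ l ω, ξ l' ω) ∂P = 0 := by
  set T : Ω → (↥(Finset.univ.erase i) → S) := fun ω q => ξ q ω with hT
  have mT : AEMeasurable T P := aemeasurable_pi_lambda _ fun q => (hlaw q).aemeasurable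
  have hT' : HasLaw T (P.map T) P := ⟨mT, rfl⟩
  have : IsProbabilityMeasure (P.map T) := Measure.isProbabilityMeasure_map mT
  have hiT : IndepFun (ξ i) T P := by
    have h0 := hind.indepFun_finset₀ {i} (Finset.univ.erase i)
      (by simp) (fun q => (hlaw q).aemeasurable)
    have hφ : Measurable fun f : ↥({i} : Finset (Fin m)) → S => f ⟨i, by simp⟩ :=
      measurable_pi_apply _
    exact h0.comp hφ measurable_id
  have hpair := hiT.hasLaw_prod (hlaw i) hT'
  set Ψ : S × (↥(Finset.univ.erase i) → S) → ℝ := fun p =>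
    h (p.1, p.2 ⟨i', by simp [hi.symm]⟩) *
      k (p.2 ⟨l, by simp [h1.symm]⟩, p.2 ⟨l', by simp [h1'.symm]⟩) with hΨ
  have mΨ : Measurable Ψ := by fun_prop
  have e : ∀ ω, h (ξ i ω, ξ i' ω) * k (ξ l ω, ξ l' ω) = Ψ (ξ i ω, T ω) := fun ω => rfl
  have mem (g : S × S → ℝ) (g2 : MemLp g 2 (μ.prod μ)) {a b : Fin m} (hab : a ≠ b) :
      MemLp (fun ω => g (ξ a ω, ξ b ω)) 2 P := by
    have hl := hasLaw_pair hlaw hind hab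
    rw [← hl.map_eq] at g2
    exact g2.comp_of_map hl.aemeasurable
  have iP : Integrable (fun ω => Ψ (ξ i ω, T ω)) P := (mem h h2 hi).integrable_mul (mem k k2 hl)
  have iΨ : Integrable Ψ (μ.prod (P.map T)) := by
    rw [← hpair.map_eq]
    exact (integrable_map_measure mΨ.aestronglyMeasurable hpair.aemeasurable).2 iP
  simp only [e]
  rw [show ∫ ω, Ψ (ξ i ω, T ω) ∂P = ∫ p, Ψ p ∂(μ.prod (P.map T)) from
    hpair.integral_comp mΨ.aestronglyMeasurable, integral_prod_symm _ iΨ]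
  simp [hΨ, integral_mul_const, hdeg]

/-- The second moment of a degenerate `U`-statistic of order two. -/
lemma integral_sq_sum_offDiag_le (hlaw : ∀ i, HasLaw (ξ i) μ P) (hind : iIndepFun ξ P)
    {h : S × S → ℝ} (mh : Measurable h) (h2 : MemLp h 2 (μ.prod μ))
    (hdeg : ∀ t, ∫ s, h (s, t) ∂μ = 0) (hdeg' : ∀ s, ∫ t, h (s, t) ∂μ = 0) :
    MemLp (fun ω => ∑ p ∈ Finset.univ.offDiag, h (ξ p.1 ω, ξ p.2 ω)) 2 P ∧
    ∫ ω, (∑ p ∈ Finset.univ.offDiag, h (ξ p.1 ω, ξ p.2 ω)) ^ 2 ∂P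
      ≤ 2 * (m : ℝ) ^ 2 * ∫ p, h p ^ 2 ∂(μ.prod μ) := by
  classical
  set f : Fin m × Fin m → Ω → ℝ := fun p ω => h (ξ p.1 ω, ξ p.2 ω) with hf
  set E := ∫ p, h p ^ 2 ∂(μ.prod μ) with hE
  have hE0 : 0 ≤ E := integral_nonneg fun p => sq_nonneg _
  have memf (p : Fin m × Fin m) (hp : p.1 ≠ p.2) : MemLp (f p) 2 P := by
    have hl := hasLaw_pair hlaw hind hp
    have h2' := h2
    rw [← hl.map_eq] at h2'
    exact h2'.comp_of_map hl.aemeasurable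
  have sqf (p : Fin m × Fin m) (hp : p.1 ≠ p.2) : ∫ ω, f p ω ^ 2 ∂P = E :=
    (hasLaw_pair hlaw hind hp).integral_comp (f := fun p => h p ^ 2)
      (mh.pow_const 2).aestronglyMeasurable
  have hswap2 : MemLp (fun p : S × S => h p.swap) 2 (μ.prod μ) :=
    h2.comp_measurePreserving Measure.measurePreserving_swap
  -- Such a `q` misses one index of `p`, and integrating over that index gives zero; if it is the
  -- second one, the kernel is swapped. Each `p` thus correlates with at most two pairs.
  have zero (p q : Fin m × Fin m) (hp : p.1 ≠ p.2) (hq : q.1 ≠ q.2) (h1 : q ≠ p)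
      (h1' : q ≠ p.swap) : ∫ ω, f p ω * f q ω ∂P = 0 := by
    obtain ⟨i, i'⟩ := p
    obtain ⟨l, l'⟩ := q
    simp only [ne_eq, Prod.mk.injEq, Prod.swap_prod_mk, not_and] at h1 h1' hp hq
    by_cases ha : i ≠ l ∧ i ≠ l'
    · exact integral_kernel_mul_eq_zero hlaw hind mh mh h2 h2 hdeg hp hq ha.1 ha.2
    · have hb : i' ≠ l ∧ i' ≠ l' := by
        by_contra hcon
        grind
      exact integral_kernel_mul_eq_zero hlaw hind (h := fun p => h p.swap)
        (mh.comp measurable_swap) mh hswap2 h2 hdeg' (Ne.symm hp) hq hb.1 hb.2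
  have le (p q : Fin m × Fin m) (hp : p.1 ≠ p.2) (hq : q.1 ≠ q.2) :
      ∫ ω, f p ω * f q ω ∂P ≤ E := by
    refine (integral_mul_le_sqrt_mul_sqrt (memf p hp) (memf q hq)).trans (le_of_eq ?_)
    rw [sqf p hp, sqf q hq, Real.mul_self_sqrt hE0]
  refine ⟨memLp_finsetSum _ fun p hp => memf p (by simpa using hp), ?_⟩
  have expand : ∀ ω, (∑ p ∈ Finset.univ.offDiag, h (ξ p.1 ω, ξ p.2 ω)) ^ 2
      = ∑ p ∈ Finset.univ.offDiag, ∑ q ∈ Finset.univ.offDiag, f p ω * f q ω := fun ω => by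
    rw [sq, Finset.sum_mul_sum]
  simp only [expand]
  have ipq (p : Fin m × Fin m) (hp : p ∈ Finset.univ.offDiag) (q : Fin m × Fin m)
      (hq : q ∈ Finset.univ.offDiag) : Integrable (fun ω => f p ω * f q ω) P :=
    (memf p (by simpa using hp)).integrable_mul (memf q (by simpa using hq))
  rw [integral_finsetSum _ fun p hp => integrable_finsetSum _ fun q hq => ipq p hp q hq]
  calc _ ≤ ∑ p ∈ (Finset.univ : Finset (Fin m)).offDiag, 2 * E := by
        refine Finset.sum_le_sum fun p hp => ?_
        rw [integral_finsetSum _ fun q hq => ipq p hp q hq]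
        have hp' : p.1 ≠ p.2 := by simpa using hp
        calc _ ≤ ∑ q ∈ (Finset.univ : Finset (Fin m)).offDiag,
              if q = p ∨ q = p.swap then E else 0 := by
              refine Finset.sum_le_sum fun q hq => ?_
              have hq' : q.1 ≠ q.2 := by simpa using hq
              split_ifs with hcase
              · exact le p q hp' hq'
              · rw [not_or] at hcase
                exact (zero p q hp' hq' hcase.1 hcase.2).le
          _ ≤ ∑ q ∈ ({p, p.swap} : Finset (Fin m × Fin m)), E := by
              rw [← Finset.sum_filter]
              refine Finset.sum_le_sum_of_subset_of_nonneg (fun q hq => ?_) fun _ _ _ => hE0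
              simpa using (Finset.mem_filter.1 hq).2
          _ ≤ 2 * E := by
              rw [Finset.sum_const, nsmul_eq_mul]
              have : ((({p, p.swap} : Finset (Fin m × Fin m)).card : ℕ) : ℝ) ≤ 2 := by
                exact_mod_cast Finset.card_le_two
              gcongr
    _ ≤ _ := by
        rw [Finset.sum_const, nsmul_eq_mul, Finset.offDiag_card]
        have : ((Finset.card (Finset.univ : Finset (Fin m)) * Finset.card
            (Finset.univ : Finset (Fin m)) - Finset.card (Finset.univ : Finset (Fin m)) : ℕ) : ℝ)
            ≤ (m : ℝ) ^ 2 := by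
          rw [sq]
          exact_mod_cast (Nat.sub_le _ _).trans (by simp)
        nlinarith

/-- The expected squared Frobenius norm of the off-diagonal part of the Gram matrix of a sum of
independent centred random matrices. -/
lemma integral_sum_sq_gram_offDiag_le {d₁ d₂ : ℕ} (hlaw : ∀ i, HasLaw (ξ i) μ P)
    (hind : iIndepFun ξ P) {f : Fin d₁ → Fin d₂ → S → ℝ} (mf : ∀ a j, Measurable (f a j))
    (hf : ∀ a j, HasAllMoments (f a j) μ) (hf0 : ∀ a j, ∫ s, f a j s ∂μ = 0) :
    Integrable (fun ω => ∑ j, ∑ l, (∑ p ∈ Finset.univ.offDiag,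
      ∑ a, f a j (ξ p.1 ω) * f a l (ξ p.2 ω)) ^ 2) P ∧
    ∫ ω, ∑ j, ∑ l, (∑ p ∈ Finset.univ.offDiag,
      ∑ a, f a j (ξ p.1 ω) * f a l (ξ p.2 ω)) ^ 2 ∂P
      ≤ 2 * (m : ℝ) ^ 2 * ∑ a, ∑ b, (∑ j, ∫ s, f a j s * f b j s ∂μ) ^ 2 := by
  have key (j l : Fin d₂) := integral_sq_sum_offDiag_le hlaw hind
    (h := fun p => ∑ a, f a j p.1 * f a l p.2) (by fun_prop)
    (memLp_finsetSum _ fun a _ => by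
      have m1 : HasAllMoments (fun p : S × S => f a j p.1) (μ.prod μ) :=
        (hf a j).comp_hasLaw measurePreserving_fst.hasLaw
      have m2 : HasAllMoments (fun p : S × S => f a l p.2) (μ.prod μ) :=
        (hf a l).comp_hasLaw measurePreserving_snd.hasLaw
      exact (m1.mul m2).memLp_two)
    (fun t => by
      simp only
      rw [integral_finsetSum _ fun a _ => (hf a j).integrable.mul_const _]
      simp [integral_mul_const, hf0])
    (fun s => by
      simp only
      rw [integral_finsetSum _ fun a _ => (hf a l).integrable.const_mul _]
      simp [integral_const_mul, hf0])
  -- The two samples separate once the square is a double sum over rows `a`, `b`. Summing over `j`,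
  -- `l` first then gives the square of a covariance summed over columns.
  have hI (j l : Fin d₂) : ∫ p : S × S, (∑ a, f a j p.1 * f a l p.2) ^ 2 ∂(μ.prod μ)
      = ∑ a, ∑ b, (∫ s, f a j s * f b j s ∂μ) * ∫ s, f a l s * f b l s ∂μ := by
    have : ∀ p : S × S, (∑ a, f a j p.1 * f a l p.2) ^ 2
        = ∑ a, ∑ b, (f a j p.1 * f b j p.1) * (f a l p.2 * f b l p.2) := fun p => by
      rw [sq, Finset.sum_mul_sum]
      exact Finset.sum_congr rfl fun a _ => Finset.sum_congr rfl fun b _ => by ring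
    simp only [this]
    have hint (a b : Fin d₁) : Integrable (fun p : S × S =>
        (f a j p.1 * f b j p.1) * (f a l p.2 * f b l p.2)) (μ.prod μ) :=
      ((hf a j).mul (hf b j)).integrable.mul_prod ((hf a l).mul (hf b l)).integrable
    rw [integral_finsetSum _ fun a _ => integrable_finsetSum _ fun b _ => hint a b]
    refine Finset.sum_congr rfl fun a _ => ?_
    rw [integral_finsetSum _ fun b _ => hint a b]
    refine Finset.sum_congr rfl fun b _ => ?_
    exact integral_prod_mul (fun s => f a j s * f b j s) fun s => f a l s * f b l s
  have hint (j l : Fin d₂) : Integrable (fun ω => (∑ p ∈ Finset.univ.offDiag,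
      ∑ a, f a j (ξ p.1 ω) * f a l (ξ p.2 ω)) ^ 2) P := (key j l).1.integrable_sq
  refine ⟨integrable_finsetSum _ fun j _ => integrable_finsetSum _ fun l _ => hint j l, ?_⟩
  rw [integral_finsetSum _ fun j _ => integrable_finsetSum _ fun l _ => hint j l]
  calc _ ≤ ∑ j, ∑ l, 2 * (m : ℝ) ^ 2 * ∑ a, ∑ b, (∫ s, f a j s * f b j s ∂μ) *
          ∫ s, f a l s * f b l s ∂μ := by
        refine Finset.sum_le_sum fun j _ => ?_
        rw [integral_finsetSum _ fun l _ => hint j l]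
        refine Finset.sum_le_sum fun l _ => ?_
        rw [← hI]
        exact (key j l).2
    _ = _ := by
        simp only [← Finset.mul_sum]
        congr 1
        simp only [sq, Finset.sum_mul_sum]
        rw [Finset.sum_congr rfl fun j _ => Finset.sum_comm, Finset.sum_comm]
        refine Finset.sum_congr rfl fun a _ => ?_
        rw [Finset.sum_congr rfl fun j _ => Finset.sum_comm, Finset.sum_comm]

end UStatistic

/-! ### Spectral norm, Frobenius norm and Gram matrices. -/

section Matrices

variable {d₁ d₂ : ℕ}

/-- The spectral norm is at most the Frobenius norm. -/
lemma sq_l2_opNorm_le_sum_sq (A : Matrix (Fin d₁) (Fin d₂) ℝ) :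
    ‖A‖ ^ 2 ≤ ∑ a, ∑ j, A a j ^ 2 := by
  have h0 : 0 ≤ ∑ a, ∑ j, A a j ^ 2 :=
    Finset.sum_nonneg fun a _ => Finset.sum_nonneg fun j _ => sq_nonneg _
  have h : ‖A‖ ≤ √(∑ a, ∑ j, A a j ^ 2) := by
    rw [Matrix.l2_opNorm_def]
    refine ContinuousLinearMap.opNorm_le_bound _ (Real.sqrt_nonneg _) fun x => ?_
    rw [EuclideanSpace.norm_eq, EuclideanSpace.norm_eq, ← Real.sqrt_mul h0]
    refine Real.sqrt_le_sqrt ?_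
    rw [Finset.sum_mul]
    refine Finset.sum_le_sum fun a _ => ?_
    simp only [Real.norm_eq_abs, sq_abs]
    exact Finset.sum_mul_sq_le_sq_mul_sq Finset.univ (fun j => A a j) fun j => x j
  calc ‖A‖ ^ 2 ≤ √(∑ a, ∑ j, A a j ^ 2) ^ 2 := by gcongr
    _ = _ := Real.sq_sqrt h0

/-- The Frobenius norm of a matrix of small rank is controlled by the spectral norm. -/
lemma sum_sq_le_rank_mul_sq_l2_opNorm (A : Matrix (Fin d₁) (Fin d₂) ℝ) :
    ∑ a, ∑ j, A a j ^ 2 ≤ A.rank * ‖A‖ ^ 2 := by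
  -- The squared Frobenius norm is the trace of `AᴴA`; this matrix has `A.rank` nonzero eigenvalues,
  -- each at most `‖A‖ ^ 2`.
  have hH : (A.conjTranspose * A).IsHermitian := Matrix.isHermitian_conjTranspose_mul_self A
  have htr : ∑ a, ∑ j, A a j ^ 2 = (A.conjTranspose * A).trace := by
    rw [Matrix.trace, Finset.sum_comm]
    refine Finset.sum_congr rfl fun j _ => ?_
    simp [Matrix.mul_apply, sq]
  have hrank : A.rank = Fintype.card {i // hH.eigenvalues i ≠ 0} := by
    rw [← hH.rank_eq_card_non_zero_eigs, Matrix.rank_conjTranspose_mul_self]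
  have hle (i : Fin d₂) : hH.eigenvalues i ≤ ‖A‖ ^ 2 := by
    have h1 := Matrix.l2_opNorm_mulVec (A.conjTranspose * A) (hH.eigenvectorBasis i)
    rw [hH.mulVec_eigenvectorBasis, Matrix.l2_opNorm_conjTranspose_mul_self] at h1
    have h2 : ‖(WithLp.toLp 2 (hH.eigenvalues i • ⇑(hH.eigenvectorBasis i)) :
        EuclideanSpace ℝ (Fin d₂))‖ = |hH.eigenvalues i| := by
      rw [show (WithLp.toLp 2 (hH.eigenvalues i • ⇑(hH.eigenvectorBasis i)) :
        EuclideanSpace ℝ (Fin d₂)) = hH.eigenvalues i • hH.eigenvectorBasis i from rfl, norm_smul]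
      simp
    have h3 : ‖hH.eigenvectorBasis i‖ = 1 := by simp
    rw [h3, mul_one, ← sq] at h1
    exact (le_abs_self _).trans (h2 ▸ h1)
  rw [htr, hH.trace_eq_sum_eigenvalues, hrank, Fintype.card_subtype]
  simp only [RCLike.ofReal_real_eq_id, id]
  calc ∑ i, hH.eigenvalues i = ∑ i with hH.eigenvalues i ≠ 0, hH.eigenvalues i := by
        rw [Finset.sum_filter_ne_zero]
    _ ≤ ∑ i with hH.eigenvalues i ≠ 0, ‖A‖ ^ 2 := Finset.sum_le_sum fun i _ => hle i
    _ = _ := by rw [Finset.sum_const, nsmul_eq_mul]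

/-- The Gram matrix of a centred sum, split into a diagonal and an off-diagonal part. -/
lemma gram_sum_sub_eq {m : ℕ} (B : Fin m → Matrix (Fin d₁) (Fin d₂) ℝ)
    (β A : Matrix (Fin d₁) (Fin d₂) ℝ) (hA : A = ∑ i, B i - (m : ℝ) • β) :
    A.conjTranspose * A = ∑ i, (B i).conjTranspose * B i
      + ∑ p ∈ Finset.univ.offDiag, (B p.1 - β).conjTranspose * (B p.2 - β)
      - A.conjTranspose * β - β.conjTranspose * A - (m : ℝ) • (β.conjTranspose * β) := by
  have h1 : A = ∑ i, (B i - β) := by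
    rw [hA, Finset.sum_sub_distrib]
    simp [Nat.cast_smul_eq_nsmul]
  have h2 : A.conjTranspose * A = ∑ i, (B i - β).conjTranspose * (B i - β)
      + ∑ p ∈ Finset.univ.offDiag, (B p.1 - β).conjTranspose * (B p.2 - β) := by
    rw [h1, Matrix.conjTranspose_sum, Matrix.sum_mul]
    simp only [Matrix.mul_sum]
    rw [← Finset.sum_product' (f := fun i i' => (B i - β).conjTranspose * (B i' - β)),
      ← Finset.diag_union_offDiag, Finset.sum_union (Finset.disjoint_diag_offDiag _),
      Finset.sum_diag]
  have h3 : ∑ i, B i = A + (m : ℝ) • β := by rw [hA]; abel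
  -- Uncentring these products keeps the one-column structure of the `B i` in the application, which
  -- makes their Gram sum diagonal; the correction is expressed through `A` itself.
  have h4 : ∑ i, (B i - β).conjTranspose * (B i - β) = ∑ i, (B i).conjTranspose * B i
      - A.conjTranspose * β - β.conjTranspose * A - (m : ℝ) • (β.conjTranspose * β) := by
    simp only [Matrix.conjTranspose_sub, Matrix.sub_mul, Matrix.mul_sub, Finset.sum_sub_distrib]
    rw [← Matrix.sum_mul, ← Matrix.mul_sum, ← Matrix.conjTranspose_sum, h3]
    simp only [Matrix.conjTranspose_add, Matrix.add_mul, Matrix.mul_add, Finset.sum_const,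
      Finset.card_univ, Fintype.card_fin, Matrix.conjTranspose_smul, Matrix.smul_mul,
      Matrix.mul_smul, star_trivial, ← Nat.cast_smul_eq_nsmul ℝ m]
    abel
  rw [h2, h4]
  abel

/-- The cross terms of the Gram identity cost `2‖A‖‖β‖ ≤ ‖A‖²/2 + 2‖β‖²`. Absorbing the first half
and using `m ≥ 1` leaves `(4 + 2m)‖β‖² ≤ 6m‖β‖²`. -/
lemma sq_l2_opNorm_sum_sub_le {m : ℕ} (hm : 1 ≤ m) (B : Fin m → Matrix (Fin d₁) (Fin d₂) ℝ)
    (β : Matrix (Fin d₁) (Fin d₂) ℝ) :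
    ‖∑ i, B i - (m : ℝ) • β‖ ^ 2 ≤ 2 * ‖∑ i, (B i).conjTranspose * B i‖
      + 2 * ‖∑ p ∈ Finset.univ.offDiag, (B p.1 - β).conjTranspose * (B p.2 - β)‖
      + 6 * m * ‖β‖ ^ 2 := by
  set A := ∑ i, B i - (m : ℝ) • β with hA
  have hm' : (1 : ℝ) ≤ m := by exact_mod_cast hm
  have h := gram_sum_sub_eq B β A hA
  set D := ∑ i, (B i).conjTranspose * B i
  set H := ∑ p ∈ Finset.univ.offDiag, (B p.1 - β).conjTranspose * (B p.2 - β)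
  have h1 : ‖A‖ ^ 2 ≤ ‖D‖ + ‖H‖ + 2 * (‖A‖ * ‖β‖) + m * ‖β‖ ^ 2 := by
    have e1 : ‖A.conjTranspose * β‖ ≤ ‖A‖ * ‖β‖ := by
      simpa only [Matrix.l2_opNorm_conjTranspose] using Matrix.l2_opNorm_mul A.conjTranspose β
    have e2 : ‖β.conjTranspose * A‖ ≤ ‖β‖ * ‖A‖ := by
      simpa only [Matrix.l2_opNorm_conjTranspose] using Matrix.l2_opNorm_mul β.conjTranspose A
    have e3 : ‖(m : ℝ) • (β.conjTranspose * β)‖ = m * ‖β‖ ^ 2 := by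
      rw [norm_smul, Matrix.l2_opNorm_conjTranspose_mul_self, sq]
      simp
    calc ‖A‖ ^ 2 = ‖A.conjTranspose * A‖ := by
          rw [Matrix.l2_opNorm_conjTranspose_mul_self, sq]
      _ ≤ ‖D‖ + ‖H‖ + ‖A.conjTranspose * β‖ + ‖β.conjTranspose * A‖
          + ‖(m : ℝ) • (β.conjTranspose * β)‖ := by
          rw [h]
          refine (norm_sub_le _ _).trans (add_le_add_left ?_ _)
          refine (norm_sub_le _ _).trans (add_le_add_left ?_ _)
          refine (norm_sub_le _ _).trans (add_le_add_left ?_ _)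
          exact norm_add_le _ _
      _ ≤ _ := by rw [e3]; linarith
  nlinarith [sq_nonneg (‖A‖ - 2 * ‖β‖), sq_nonneg ‖β‖]

/-- A sum of nonnegative numbers is controlled by its largest term and the products of pairs. -/
lemma sq_sum_le_add_sum_offDiag {ι : Type*} [DecidableEq ι] (s : Finset ι) {t : ι → ℝ} {M : ℝ}
    (ht : ∀ i ∈ s, 0 ≤ t i) (hM : ∀ i ∈ s, t i ^ 2 ≤ M) (hM0 : 0 ≤ M) :
    (∑ i ∈ s, t i) ^ 2 ≤ M + 2 * ∑ p ∈ s.offDiag, t p.1 * t p.2 := by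
  have h1 : (∑ i ∈ s, t i) ^ 2 = ∑ i ∈ s, t i ^ 2 + ∑ p ∈ s.offDiag, t p.1 * t p.2 := by
    rw [sq, Finset.sum_mul_sum, ← Finset.sum_product', ← Finset.diag_union_offDiag,
      Finset.sum_union (Finset.disjoint_diag_offDiag _), Finset.sum_diag]
    simp only [sq]
  have h2 : ∑ i ∈ s, t i ^ 2 ≤ √M * ∑ i ∈ s, t i := by
    rw [Finset.mul_sum]
    refine Finset.sum_le_sum fun i hi => ?_
    rw [sq]
    exact mul_le_mul_of_nonneg_right (Real.le_sqrt_of_sq_le (hM i hi)) (ht i hi)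
  -- With `T` the sum, `√M T ≤ (M + T²) / 2`, and the `T²` is absorbed on the left.
  nlinarith [sq_nonneg (√M - ∑ i ∈ s, t i), Real.sq_sqrt hM0]

lemma sum_conjTranspose_mul_vecMulVec_single {m : ℕ} (u : Fin m → Fin d₁ → ℝ)
    (c : Fin m → Fin d₂) :
    ∑ i, (Matrix.vecMulVec (u i) (Pi.single (c i) 1)).conjTranspose
        * Matrix.vecMulVec (u i) (Pi.single (c i) 1)
      = Matrix.diagonal fun j => ∑ i, if c i = j then u i ⬝ᵥ u i else 0 := by
  ext j l
  simp only [Matrix.sum_apply, Matrix.mul_apply, Matrix.conjTranspose_apply,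
    Matrix.vecMulVec_apply, star_trivial, Matrix.diagonal_apply, Pi.single_apply]
  split_ifs with h
  · subst h
    refine Finset.sum_congr rfl fun i _ => ?_
    by_cases hc : c i = j
    · simp [hc, dotProduct]
    · simp [hc, Ne.symm hc]
  · refine Finset.sum_eq_zero fun i _ => Finset.sum_eq_zero fun a _ => ?_
    by_cases hj : j = c i
    · have : l ≠ c i := fun hl => h (hj.trans hl.symm)
      simp [this]
    · simp [hj]

/-- The spectral norm of the diagonal Gram part of a sum of one-column matrices. -/
lemma sq_l2_opNorm_diagonal_sum_le {m : ℕ} {t : Fin m → ℝ} (c : Fin m → Fin d₂) {M : ℝ}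
    (ht : ∀ i, 0 ≤ t i) (hM : ∀ i, t i ^ 2 ≤ M) (hM0 : 0 ≤ M) :
    ‖Matrix.diagonal fun j => ∑ i, if c i = j then t i else 0‖ ^ 2
      ≤ M + 2 * ∑ j, ∑ p ∈ Finset.univ.offDiag,
        (if c p.1 = j then t p.1 else 0) * (if c p.2 = j then t p.2 else 0) := by
  have hn (j : Fin d₂) (i : Fin m) : 0 ≤ if c i = j then t i else 0 := by
    split_ifs
    · exact ht i
    · exact le_rfl
  have hpos (j : Fin d₂) : 0 ≤ ∑ p ∈ Finset.univ.offDiag,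
      (if c p.1 = j then t p.1 else 0) * (if c p.2 = j then t p.2 else 0) :=
    Finset.sum_nonneg fun p _ => mul_nonneg (hn j _) (hn j _)
  set R := M + 2 * ∑ j, ∑ p ∈ Finset.univ.offDiag,
        (if c p.1 = j then t p.1 else 0) * (if c p.2 = j then t p.2 else 0) with hR
  have hR0 : 0 ≤ R := add_nonneg hM0 (mul_nonneg (by norm_num) (Finset.sum_nonneg fun j _ => hpos j))
  have h : ‖Matrix.diagonal fun j => ∑ i, if c i = j then t i else 0‖ ≤ √R := by
    rw [Matrix.l2_opNorm_diagonal, pi_norm_le_iff_of_nonneg (Real.sqrt_nonneg _)]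
    intro j
    rw [Real.norm_eq_abs]
    refine Real.le_sqrt_of_sq_le ?_
    rw [sq_abs]
    refine (sq_sum_le_add_sum_offDiag Finset.univ (fun i _ => hn j i) (M := M) (fun i _ => ?_)
      hM0).trans ?_
    · split_ifs
      · exact hM i
      · simpa using hM0
    -- The maximum over columns is replaced by a sum only for the pair products; `M` is paid once.
    · have := Finset.single_le_sum (fun j _ => hpos j) (Finset.mem_univ j)
      linarith
  calc _ ≤ √R ^ 2 := by gcongr
    _ = R := Real.sq_sqrt hR0

end Matrices

/-! ### Moments of a single observation. -/

section Model

variable {d₁ d₂ : ℕ}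

/-- The law of one pair `(x_i, j_i)`. -/
noncomputable abbrev pairLaw (d₁ d₂ : ℕ) : Measure ((Fin d₁ → ℝ) × Fin d₂) :=
  (gaussianPi d₁).prod (uniformOn Set.univ)

lemma isProbabilityMeasure_uniformOn_univ [NeZero d₂] :
    IsProbabilityMeasure (uniformOn (Set.univ : Set (Fin d₂))) :=
  isProbabilityMeasure_uniformOn Set.finite_univ Set.univ_nonempty

/-- Each summand is a product of functions of one coordinate, which reduces the pair law to one
Gaussian integral per column. -/
lemma eq_sum_indicator (f : (Fin d₁ → ℝ) × Fin d₂ → ℝ) :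
    f = fun p => ∑ c, f (p.1, c) * (if p.2 = c then 1 else 0) := by
  ext ⟨x, c⟩
  simp

lemma hasAllMoments_pairLaw [NeZero d₂] {f : (Fin d₁ → ℝ) × Fin d₂ → ℝ}
    (hf : ∀ c, HasAllMoments (fun x => f (x, c)) (gaussianPi d₁)) :
    HasAllMoments f (pairLaw d₁ d₂) := by
  have := isProbabilityMeasure_uniformOn_univ (d₂ := d₂)
  rw [eq_sum_indicator f]
  refine HasAllMoments.sum fun c _ => HasAllMoments.mul
    ((hf c).comp_hasLaw measurePreserving_fst.hasLaw) (.of_bound ?_ 1 fun p => ?_)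
  · exact (Measurable.ite (measurable_snd (measurableSet_singleton c)) measurable_const
      measurable_const).aestronglyMeasurable
  · split_ifs <;> simp

lemma integral_pairLaw [NeZero d₂] {f : (Fin d₁ → ℝ) × Fin d₂ → ℝ}
    (hf : ∀ c, HasAllMoments (fun x => f (x, c)) (gaussianPi d₁)) :
    ∫ p, f p ∂pairLaw d₁ d₂ = (∑ c, ∫ x, f (x, c) ∂gaussianPi d₁) / d₂ := by
  have := isProbabilityMeasure_uniformOn_univ (d₂ := d₂)
  have hsing (c : Fin d₂) : ∫ c', (if c' = c then (1 : ℝ) else 0)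
      ∂(uniformOn (Set.univ : Set (Fin d₂))) = (d₂ : ℝ)⁻¹ := by
    have : (fun c' => if c' = c then (1 : ℝ) else 0) = Set.indicator {c} fun _ => (1 : ℝ) := by
      ext c'; simp [Set.indicator]
    rw [this, integral_indicator_const _ (measurableSet_singleton c), measureReal_def,
      uniformOn_univ]
    simp
  have hi (c : Fin d₂) : Integrable (fun p : (Fin d₁ → ℝ) × Fin d₂ =>
      f (p.1, c) * if p.2 = c then (1 : ℝ) else 0) (pairLaw d₁ d₂) :=
    (hf c).integrable.mul_prod (g := fun c' => if c' = c then (1 : ℝ) else 0) .of_finite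
  conv_lhs => rw [eq_sum_indicator f]
  beta_reduce
  rw [integral_finsetSum _ fun c _ => hi c, Finset.sum_div]
  refine Finset.sum_congr rfl fun c _ => ?_
  rw [integral_prod_mul (fun x => f (x, c)) fun c' => if c' = c then (1 : ℝ) else 0, hsing]
  rfl

/-- The difference of the two one-bit measurements of a pair. -/
noncomputable def signGap (W W' : Matrix (Fin d₁) (Fin d₂) ℝ) (p : (Fin d₁ → ℝ) × Fin d₂) : ℝ :=
  sign (p.1 ⬝ᵥ W.col p.2) - sign (p.1 ⬝ᵥ W'.col p.2)

/-- The Euclidean distance of two corresponding columns. -/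
noncomputable def colDist (W W' : Matrix (Fin d₁) (Fin d₂) ℝ) (c : Fin d₂) : ℝ :=
  √((W.col c - W'.col c) ⬝ᵥ (W.col c - W'.col c))

variable (W W' : Matrix (Fin d₁) (Fin d₂) ℝ)

lemma measurable_signGap : Measurable (signGap W W') :=
  measurable_from_prod_countable_left fun c => measurable_sign_sub_sign (W.col c) (W'.col c)

lemma hasAllMoments_signGap (c : Fin d₂) :
    HasAllMoments (fun x => signGap W W' (x, c)) (gaussianPi d₁) :=
  hasAllMoments_sign_sub_sign (W.col c) (W'.col c)

lemma sq_colDist (c : Fin d₂) : colDist W W' c ^ 2 = ∑ a, (W - W') a c ^ 2 := by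
  rw [colDist, Real.sq_sqrt (dotProduct_self_nonneg_real _)]
  simp [dotProduct, Matrix.col, sq]

lemma sum_sq_colDist : ∑ c, colDist W W' c ^ 2 = ∑ a, ∑ c, (W - W') a c ^ 2 := by
  rw [Finset.sum_comm]
  exact Finset.sum_congr rfl fun c _ => sq_colDist W W' c

lemma colDist_nonneg (c : Fin d₂) : 0 ≤ colDist W W' c := Real.sqrt_nonneg _

variable {W W'}

lemma sq_colDist_le (hW : ∀ c, W.col c ⬝ᵥ W.col c = 1) (hW' : ∀ c, W'.col c ⬝ᵥ W'.col c = 1)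
    (c : Fin d₂) : colDist W W' c ^ 2 ≤ 4 := by
  have h := dotProduct_self_nonneg_real (W.col c + W'.col c)
  rw [colDist, Real.sq_sqrt (dotProduct_self_nonneg_real _)]
  simp only [sub_dotProduct, dotProduct_sub, add_dotProduct, dotProduct_add, hW, hW'] at h ⊢
  linarith

variable (W W') in
/-- The entry `(a, j)` of the random matrix `y x eᵀ`. -/
noncomputable def gapEntry (a : Fin d₁) (j : Fin d₂) (p : (Fin d₁ → ℝ) × Fin d₂) : ℝ :=
  if p.2 = j then signGap W W' p * p.1 a else 0

lemma measurable_gapEntry (a : Fin d₁) (j : Fin d₂) : Measurable (gapEntry W W' a j) :=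
  Measurable.ite (measurable_snd (measurableSet_singleton j))
    ((measurable_signGap W W').mul ((measurable_pi_apply a).comp measurable_fst)) measurable_const

lemma hasAllMoments_gapEntry_slice (a : Fin d₁) (j c : Fin d₂) :
    HasAllMoments (fun x => gapEntry W W' a j (x, c)) (gaussianPi d₁) := by
  by_cases h : c = j
  · simp only [gapEntry, h, if_true]
    exact (hasAllMoments_signGap W W' j).mul (hasAllMoments_eval_gaussianPi a)
  · simp only [gapEntry, h, if_false]
    exact .const 0

lemma integral_gapEntry [NeZero d₂] (hW : ∀ c, W.col c ⬝ᵥ W.col c = 1)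
    (hW' : ∀ c, W'.col c ⬝ᵥ W'.col c = 1) (a : Fin d₁) (j : Fin d₂) :
    ∫ p, gapEntry W W' a j p ∂pairLaw d₁ d₂ = √(2 / Real.pi) / d₂ * (W - W') a j := by
  rw [integral_pairLaw fun c => hasAllMoments_gapEntry_slice a j c, Finset.sum_eq_single j]
  · have hs (w : Fin d₁ → ℝ) : HasAllMoments (fun x => sign (x ⬝ᵥ w) * x a) (gaussianPi d₁) :=
      HasAllMoments.mul (.of_bound (measurable_sign.comp (by fun_prop)).aestronglyMeasurable 1
        fun x => (abs_sign _).le) (hasAllMoments_eval_gaussianPi a)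
    simp only [gapEntry, signGap, if_true, sub_mul]
    rw [integral_sub (hs _).integrable (hs _).integrable, integral_sign_mul_eval (hW j),
      integral_sign_mul_eval (hW' j)]
    simp [Matrix.col]
    ring
  · intro c _ hc
    simp [gapEntry, hc]
  · simp

lemma sum_gapEntry_mul (a b : Fin d₁) (p : (Fin d₁ → ℝ) × Fin d₂) :
    ∑ j, gapEntry W W' a j p * gapEntry W W' b j p = signGap W W' p ^ 2 * (p.1 a * p.1 b) := by
  simp [gapEntry]
  ring

/-- A bound for all directional second moments bounds the Frobenius norm of the second moment
matrix. -/
lemma sum_sq_secondMoment_le {α : Type*} [MeasurableSpace α] {μ : Measure α} [IsFiniteMeasure μ]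
    {v : Fin d₁ → α → ℝ} (hv : ∀ a, HasAllMoments (v a) μ) {κ : ℝ} (hκ : 0 ≤ κ)
    (h : ∀ u : Fin d₁ → ℝ, ∫ s, (∑ a, v a s * u a) ^ 2 ∂μ ≤ κ * (u ⬝ᵥ u)) :
    ∑ a, ∑ b, (∫ s, v a s * v b s ∂μ) ^ 2 ≤ d₁ * κ ^ 2 := by
  -- Testing against the row `g` itself: `|g|²` is the mean of `v a` times `∑ b, v b * g b`, hence
  -- at most `√κ √(κ |g|²)`, so `|g| ≤ κ`.
  have key (a : Fin d₁) : ∑ b, (∫ s, v a s * v b s ∂μ) ^ 2 ≤ κ ^ 2 := by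
    set g : Fin d₁ → ℝ := fun b => ∫ s, v a s * v b s ∂μ with hg
    have hN : ∑ b, (∫ s, v a s * v b s ∂μ) ^ 2 = g ⬝ᵥ g := by simp [dotProduct, hg, sq]
    have hN0 := dotProduct_self_nonneg_real g
    have hsum : HasAllMoments (fun s => ∑ b, v b s * g b) μ :=
      HasAllMoments.sum fun b _ => (hv b).mul (.const (g b))
    have h1 : g ⬝ᵥ g = ∫ s, v a s * ∑ b, v b s * g b ∂μ := by
      simp only [Finset.mul_sum, ← mul_assoc]
      rw [integral_finsetSum _ fun b _ => (((hv a).mul (hv b)).mul (.const (g b))).integrable]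
      simp only [integral_mul_const]
      rfl
    have h2 : ∫ s, v a s ^ 2 ∂μ ≤ κ := by
      have := h (Pi.single a 1)
      simpa [Pi.single_apply] using this
    have h3 : g ⬝ᵥ g ≤ √κ * √(κ * (g ⬝ᵥ g)) := by
      conv_lhs => rw [h1]
      refine (integral_mul_le_sqrt_mul_sqrt (hv a).memLp_two hsum.memLp_two).trans ?_
      gcongr
      exact h g
    rw [Real.sqrt_mul hκ, ← mul_assoc, Real.mul_self_sqrt hκ] at h3
    rw [hN]
    have h4 := Real.sq_sqrt hN0
    nlinarith [sq_nonneg (√(g ⬝ᵥ g) - κ)]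
  calc _ ≤ ∑ _a : Fin d₁, κ ^ 2 := Finset.sum_le_sum fun a _ => key a
    _ = _ := by simp

lemma integral_signGap_sq_mul_le [NeZero d₂] (hW : ∀ c, W.col c ⬝ᵥ W.col c = 1)
    (hW' : ∀ c, W'.col c ⬝ᵥ W'.col c = 1) {K : ℝ}
    (hK2 : ∀ (w w' u : Fin d₁ → ℝ), w ⬝ᵥ w = 1 → w' ⬝ᵥ w' = 1 →
      ∫ x, (sign (x ⬝ᵥ w) - sign (x ⬝ᵥ w')) ^ 2 * (x ⬝ᵥ u) ^ 2 ∂gaussianPi d₁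
        ≤ K * √((w - w') ⬝ᵥ (w - w')) * (u ⬝ᵥ u)) (u : Fin d₁ → ℝ) :
    ∫ p, (∑ a, signGap W W' p * p.1 a * u a) ^ 2 ∂pairLaw d₁ d₂
      ≤ K * ((∑ c, colDist W W' c) / d₂) * (u ⬝ᵥ u) := by
  have e (p : (Fin d₁ → ℝ) × Fin d₂) : (∑ a, signGap W W' p * p.1 a * u a) ^ 2
      = signGap W W' p ^ 2 * (p.1 ⬝ᵥ u) ^ 2 := by
    simp only [mul_assoc, ← Finset.mul_sum, mul_pow, dotProduct]
  simp only [e]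
  rw [integral_pairLaw fun c => ((hasAllMoments_signGap W W' c).pow 2).mul
    ((hasAllMoments_dotProduct u).pow 2)]
  calc _ ≤ (∑ c, K * colDist W W' c * (u ⬝ᵥ u)) / d₂ :=
        div_le_div_of_nonneg_right
          (Finset.sum_le_sum fun c _ => hK2 (W.col c) (W'.col c) u (hW c) (hW' c))
          (Nat.cast_nonneg _)
    _ = _ := by
        rw [← Finset.sum_mul, ← Finset.mul_sum]
        ring

lemma hasAllMoments_gapEntry [NeZero d₂] (a : Fin d₁) (j : Fin d₂) :
    HasAllMoments (gapEntry W W' a j) (pairLaw d₁ d₂) :=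
  hasAllMoments_pairLaw fun c => hasAllMoments_gapEntry_slice a j c

lemma integral_centred_mul {α : Type*} [MeasurableSpace α] {μ : Measure α}
    [IsProbabilityMeasure μ] {f g : α → ℝ} (hf : HasAllMoments f μ) (hg : HasAllMoments g μ)
    {s t : ℝ} (hs : ∫ p, f p ∂μ = s) (ht : ∫ p, g p ∂μ = t) :
    ∫ p, (f p - s) * (g p - t) ∂μ = (∫ p, f p * g p ∂μ) - s * t := by
  have e : ∀ p, (f p - s) * (g p - t) = f p * g p - t * f p - s * g p + s * t := fun p => by ring
  have i1 := hf.mul hg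
  have i2 := (HasAllMoments.const t).mul hf
  have i3 := (HasAllMoments.const s).mul hg
  simp only [e]
  rw [integral_add ((i1.sub i2).sub i3).integrable (integrable_const _),
    integral_sub (i1.sub i2).integrable i3.integrable,
    integral_sub i1.integrable i2.integrable, integral_const_mul, integral_const_mul, hs, ht]
  simp
  ring

/-- Exactly one column indicator is active in each observation, so summing over columns removes it
and leaves the second moments of `y x`, to which directional bounds apply. -/
lemma sum_covariance_gapEntry [NeZero d₂] {β : Matrix (Fin d₁) (Fin d₂) ℝ}
    (hβ : ∀ a j, ∫ p, gapEntry W W' a j p ∂pairLaw d₁ d₂ = β a j) (a b : Fin d₁) :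
    ∑ j, ∫ p, (gapEntry W W' a j p - β a j) * (gapEntry W W' b j p - β b j) ∂pairLaw d₁ d₂
      = (∫ p, (signGap W W' p * p.1 a) * (signGap W W' p * p.1 b) ∂pairLaw d₁ d₂)
        - ∑ j, β a j * β b j := by
  have := isProbabilityMeasure_uniformOn_univ (d₂ := d₂)
  rw [Finset.sum_congr rfl fun j _ => integral_centred_mul (hasAllMoments_gapEntry a j)
    (hasAllMoments_gapEntry b j) (hβ a j) (hβ b j), Finset.sum_sub_distrib,
    ← integral_finsetSum _ fun j _ =>
      ((hasAllMoments_gapEntry a j).mul (hasAllMoments_gapEntry b j)).integrable]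
  simp only [sum_gapEntry_mul]
  congr 2
  ext p
  ring

/-- The Frobenius norm of the covariance of `y x eᵀ`, summed over the columns. -/
lemma sum_sq_covariance_gapEntry_le [NeZero d₂] (hW : ∀ c, W.col c ⬝ᵥ W.col c = 1)
    (hW' : ∀ c, W'.col c ⬝ᵥ W'.col c = 1) {K : ℝ} (hK : 0 ≤ K)
    (hK2 : ∀ (w w' u : Fin d₁ → ℝ), w ⬝ᵥ w = 1 → w' ⬝ᵥ w' = 1 →
      ∫ x, (sign (x ⬝ᵥ w) - sign (x ⬝ᵥ w')) ^ 2 * (x ⬝ᵥ u) ^ 2 ∂gaussianPi d₁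
        ≤ K * √((w - w') ⬝ᵥ (w - w')) * (u ⬝ᵥ u)) {β : Matrix (Fin d₁) (Fin d₂) ℝ}
    (hβ : ∀ a j, ∫ p, gapEntry W W' a j p ∂pairLaw d₁ d₂ = β a j) :
    ∑ a, ∑ b, (∑ j, ∫ p, (gapEntry W W' a j p - β a j) * (gapEntry W W' b j p - β b j)
        ∂pairLaw d₁ d₂) ^ 2
      ≤ 2 * (d₁ * (K * ((∑ c, colDist W W' c) / d₂)) ^ 2) + 2 * (∑ a, ∑ j, β a j ^ 2) ^ 2 := by
  have := isProbabilityMeasure_uniformOn_univ (d₂ := d₂)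
  have mv (a : Fin d₁) : HasAllMoments (fun p => signGap W W' p * p.1 a) (pairLaw d₁ d₂) :=
    hasAllMoments_pairLaw fun c => (hasAllMoments_signGap W W' c).mul
      (hasAllMoments_eval_gaussianPi a)
  have hκ : 0 ≤ K * ((∑ c, colDist W W' c) / d₂) :=
    mul_nonneg hK (div_nonneg (Finset.sum_nonneg fun c _ => colDist_nonneg W W' c)
      (Nat.cast_nonneg _))
  have hG := sum_sq_secondMoment_le mv hκ (integral_signGap_sq_mul_le hW hW' hK2)
  have hN : ∑ a, ∑ b, (∑ j, β a j * β b j) ^ 2 ≤ (∑ a, ∑ j, β a j ^ 2) ^ 2 := by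
    rw [sq (∑ a, ∑ j, β a j ^ 2), Finset.sum_mul_sum]
    exact Finset.sum_le_sum fun a _ => Finset.sum_le_sum fun b _ =>
      Finset.sum_mul_sq_le_sq_mul_sq _ _ _
  simp only [sum_covariance_gapEntry hβ]
  have hsq (s t : ℝ) : (s - t) ^ 2 ≤ 2 * s ^ 2 + 2 * t ^ 2 := by nlinarith [sq_nonneg (s + t)]
  refine (Finset.sum_le_sum fun a _ => Finset.sum_le_sum fun b _ => hsq _ _).trans ?_
  simp only [Finset.sum_add_distrib, ← Finset.mul_sum]
  linarith

end Model

/-! ### Fourth moment of the deviation. -/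

section Deviation

variable {d₁ d₂ m : ℕ} (W W' : Matrix (Fin d₁) (Fin d₂) ℝ)

/-- The contribution `y x eᵀ` of one pair. -/
noncomputable def gapMatrix (p : (Fin d₁ → ℝ) × Fin d₂) : Matrix (Fin d₁) (Fin d₂) ℝ :=
  Matrix.vecMulVec (signGap W W' p • p.1) (Pi.single p.2 1)

lemma gapMatrix_apply (p : (Fin d₁ → ℝ) × Fin d₂) (a : Fin d₁) (j : Fin d₂) :
    gapMatrix W W' p a j = gapEntry W W' a j p := by
  simp [gapMatrix, gapEntry, Matrix.vecMulVec_apply, Pi.single_apply, eq_comm]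

/-- The squared length of the contribution of one pair to the column `j`. -/
noncomputable def gapWeight (j : Fin d₂) (p : (Fin d₁ → ℝ) × Fin d₂) : ℝ :=
  if p.2 = j then signGap W W' p ^ 2 * (p.1 ⬝ᵥ p.1) else 0

/-- The fluctuation of the squared length of the contribution of one pair. -/
noncomputable def gapFluctuation (p : (Fin d₁ → ℝ) × Fin d₂) : ℝ :=
  signGap W W' p ^ 2 * (p.1 ⬝ᵥ p.1 - d₁) ^ 2

/-- A polynomial upper bound for the fourth power of the deviation. -/
noncomputable def deviationBound (β : Matrix (Fin d₁) (Fin d₂) ℝ)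
    (p : Fin m → (Fin d₁ → ℝ) × Fin d₂) : ℝ :=
  12 * (32 * (d₁ : ℝ) ^ 2 + 8 * ∑ i, gapFluctuation W W' (p i)
      + 2 * ∑ j, ∑ q ∈ Finset.univ.offDiag, gapWeight W W' j (p q.1) * gapWeight W W' j (p q.2))
    + 12 * ∑ j, ∑ l, (∑ q ∈ Finset.univ.offDiag, ∑ a, (gapEntry W W' a j (p q.1) - β a j) *
        (gapEntry W W' a l (p q.2) - β a l)) ^ 2
    + 108 * (m : ℝ) ^ 2 * (∑ a, ∑ j, β a j ^ 2) ^ 2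

lemma gapFluctuation_nonneg (p : (Fin d₁ → ℝ) × Fin d₂) : 0 ≤ gapFluctuation W W' p :=
  mul_nonneg (sq_nonneg _) (sq_nonneg _)

/-- The Gram bound is squared. A diagonal term `g² N` satisfies `(g² N)² = 4 g² N² ≤ 32 d₁² + 8 g²
(N - d₁)²`, so passing from the largest observation to a sum multiplies only the fluctuations by the
sample size, not `d₁²`. -/
lemma l2_opNorm_pow_four_le_deviationBound (hm : 1 ≤ m) (β : Matrix (Fin d₁) (Fin d₂) ℝ)
    (p : Fin m → (Fin d₁ → ℝ) × Fin d₂) :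
    ‖∑ i, gapMatrix W W' (p i) - (m : ℝ) • β‖ ^ 4 ≤ deviationBound W W' β p := by
  have h1 := sq_l2_opNorm_sum_sub_le hm (fun i => gapMatrix W W' (p i)) β
  have hD : ‖∑ i, (gapMatrix W W' (p i)).conjTranspose * gapMatrix W W' (p i)‖ ^ 2
      ≤ 32 * (d₁ : ℝ) ^ 2 + 8 * ∑ i, gapFluctuation W W' (p i)
      + 2 * ∑ j, ∑ q ∈ Finset.univ.offDiag,
        gapWeight W W' j (p q.1) * gapWeight W W' j (p q.2) := by
    simp only [gapMatrix]
    rw [sum_conjTranspose_mul_vecMulVec_single (fun i => signGap W W' (p i) • (p i).1)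
      fun i => (p i).2]
    have e (i : Fin m) : (signGap W W' (p i) • (p i).1) ⬝ᵥ (signGap W W' (p i) • (p i).1)
        = signGap W W' (p i) ^ 2 * ((p i).1 ⬝ᵥ (p i).1) := by
      simp only [smul_dotProduct, dotProduct_smul, smul_eq_mul]
      ring
    simp only [e]
    have hS : 0 ≤ ∑ i, gapFluctuation W W' (p i) :=
      Finset.sum_nonneg fun i _ => gapFluctuation_nonneg W W' _
    refine sq_l2_opNorm_diagonal_sum_le (fun i => (p i).2)
      (t := fun i => signGap W W' (p i) ^ 2 * ((p i).1 ⬝ᵥ (p i).1))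
      (fun i => mul_nonneg (sq_nonneg _) (dotProduct_self_nonneg_real _)) (fun i => ?_)
      (by positivity)
    have hi := Finset.single_le_sum (fun i _ => gapFluctuation_nonneg W W' (p i))
      (Finset.mem_univ i)
    have h4 : signGap W W' (p i) ^ 4 = 4 * signGap W W' (p i) ^ 2 := sign_sub_sign_pow_four _ _
    have h5 : signGap W W' (p i) ^ 2 ≤ 4 := sq_sign_sub_sign_le _ _
    have h0 := sq_nonneg (signGap W W' (p i))
    simp only [gapFluctuation] at hi hS ⊢
    set g := signGap W W' (p i)
    set N := (p i).1 ⬝ᵥ (p i).1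
    calc (g ^ 2 * N) ^ 2 = g ^ 4 * N ^ 2 := by ring
      _ = 4 * (g ^ 2 * N ^ 2) := by rw [h4]; ring
      _ ≤ 4 * (g ^ 2 * (2 * (d₁ : ℝ) ^ 2 + 2 * (N - d₁) ^ 2)) := by
          gcongr
          nlinarith [sq_nonneg (N - 2 * d₁)]
      _ ≤ _ := by nlinarith [mul_le_mul_of_nonneg_right h5 (sq_nonneg (d₁ : ℝ))]
  have hH : ‖∑ q ∈ Finset.univ.offDiag, (gapMatrix W W' (p q.1) - β).conjTranspose *
      (gapMatrix W W' (p q.2) - β)‖ ^ 2 ≤ ∑ j, ∑ l, (∑ q ∈ Finset.univ.offDiag,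
        ∑ a, (gapEntry W W' a j (p q.1) - β a j) * (gapEntry W W' a l (p q.2) - β a l)) ^ 2 := by
    refine (sq_l2_opNorm_le_sum_sq _).trans (le_of_eq ?_)
    simp [Matrix.sum_apply, Matrix.mul_apply, gapMatrix_apply]
  have hβ := sq_l2_opNorm_le_sum_sq β
  have hβ2 : (‖β‖ ^ 2) ^ 2 ≤ (∑ a, ∑ j, β a j ^ 2) ^ 2 := pow_le_pow_left₀ (sq_nonneg _) hβ 2
  have h2 := pow_le_pow_left₀ (sq_nonneg _) h1 2
  have h3 (a b c : ℝ) : (2 * a + 2 * b + 6 * m * c) ^ 2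
      ≤ 12 * a ^ 2 + 12 * b ^ 2 + 108 * (m : ℝ) ^ 2 * c ^ 2 := by
    nlinarith [sq_nonneg (2 * a - 2 * b), sq_nonneg (2 * a - 6 * m * c),
      sq_nonneg (2 * b - 6 * m * c)]
  have h4 := mul_le_mul_of_nonneg_left hβ2 (by positivity : 0 ≤ 108 * (m : ℝ) ^ 2)
  rw [← pow_mul] at h2
  refine h2.trans ((h3 _ _ _).trans ?_)
  unfold deviationBound
  gcongr

variable {W W'}

lemma measurable_gapWeight (j : Fin d₂) : Measurable (gapWeight W W' j) :=
  Measurable.ite (measurable_snd (measurableSet_singleton j))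
    (((measurable_signGap W W').pow_const 2).mul (by fun_prop)) measurable_const

lemma measurable_gapFluctuation : Measurable (gapFluctuation W W') :=
  ((measurable_signGap W W').pow_const 2).mul (by fun_prop)

lemma hasAllMoments_gapWeight_slice (j c : Fin d₂) :
    HasAllMoments (fun x => gapWeight W W' j (x, c)) (gaussianPi d₁) := by
  by_cases h : c = j
  · simp only [gapWeight, h, if_true]
    exact ((hasAllMoments_signGap W W' j).pow 2).mul hasAllMoments_dotProduct_self
  · simp only [gapWeight, h, if_false]
    exact .const 0

lemma hasAllMoments_gapFluctuation_slice (c : Fin d₂) :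
    HasAllMoments (fun x => gapFluctuation W W' (x, c)) (gaussianPi d₁) :=
  ((hasAllMoments_signGap W W' c).pow 2).mul ((hasAllMoments_dotProduct_self.sub (.const _)).pow 2)

/-- The squared norm is a sum over the `d₁` coordinate directions, each covered by the directional
bound. -/
lemma integral_gapWeight_le [NeZero d₂] (hW : ∀ c, W.col c ⬝ᵥ W.col c = 1)
    (hW' : ∀ c, W'.col c ⬝ᵥ W'.col c = 1) {K : ℝ}
    (hK2 : ∀ (w w' u : Fin d₁ → ℝ), w ⬝ᵥ w = 1 → w' ⬝ᵥ w' = 1 →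
      ∫ x, (sign (x ⬝ᵥ w) - sign (x ⬝ᵥ w')) ^ 2 * (x ⬝ᵥ u) ^ 2 ∂gaussianPi d₁
        ≤ K * √((w - w') ⬝ᵥ (w - w')) * (u ⬝ᵥ u)) (j : Fin d₂) :
    ∫ p, gapWeight W W' j p ∂pairLaw d₁ d₂ ≤ K * d₁ * colDist W W' j / d₂ := by
  rw [integral_pairLaw fun c => hasAllMoments_gapWeight_slice j c, Finset.sum_eq_single j]
  · refine div_le_div_of_nonneg_right ?_ (Nat.cast_nonneg _)
    have e (x : Fin d₁ → ℝ) : gapWeight W W' j (x, j)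
        = ∑ a, signGap W W' (x, j) ^ 2 * (x ⬝ᵥ Pi.single a 1) ^ 2 := by
      simp only [dotProduct_single, mul_one, ← Finset.mul_sum, gapWeight, if_true]
      simp [dotProduct, sq]
    simp only [e]
    rw [integral_finsetSum _ fun a _ => (((hasAllMoments_signGap W W' j).pow 2).mul
      ((hasAllMoments_dotProduct _).pow 2)).integrable]
    calc _ ≤ ∑ a : Fin d₁, K * colDist W W' j *
          ((Pi.single a 1 : Fin d₁ → ℝ) ⬝ᵥ Pi.single a 1) :=
          Finset.sum_le_sum fun a _ => hK2 (W.col j) (W'.col j) _ (hW j) (hW' j)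
      _ = _ := by
          simp
          ring
  · intro c _ hc
    simp [gapWeight, hc]
  · simp

lemma integral_gapFluctuation_le [NeZero d₂] (hW : ∀ c, W.col c ⬝ᵥ W.col c = 1)
    (hW' : ∀ c, W'.col c ⬝ᵥ W'.col c = 1) {K : ℝ}
    (hK3 : ∀ (w w' : Fin d₁ → ℝ), w ⬝ᵥ w = 1 → w' ⬝ᵥ w' = 1 →
      ∫ x, (sign (x ⬝ᵥ w) - sign (x ⬝ᵥ w')) ^ 2 * (x ⬝ᵥ x - d₁) ^ 2 ∂gaussianPi d₁
        ≤ K * d₁ * √((w - w') ⬝ᵥ (w - w'))) :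
    ∫ p, gapFluctuation W W' p ∂pairLaw d₁ d₂ ≤ K * d₁ * (∑ c, colDist W W' c) / d₂ := by
  rw [integral_pairLaw fun c => hasAllMoments_gapFluctuation_slice c, Finset.mul_sum]
  exact div_le_div_of_nonneg_right
    (Finset.sum_le_sum fun c _ => hK3 (W.col c) (W'.col c) (hW c) (hW' c)) (Nat.cast_nonneg _)

variable {Ω : Type*} [MeasurableSpace Ω] {P : Measure Ω} [IsProbabilityMeasure P]
  {ξ : Fin m → Ω → (Fin d₁ → ℝ) × Fin d₂}

lemma integrable_and_integral_affine {X Y Z : Ω → ℝ}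
    (hX : Integrable X P) (hY : Integrable Y P) (hZ : Integrable Z P) (s t : ℝ) :
    Integrable (fun ω => 12 * (s + 8 * X ω + 2 * Y ω) + 12 * Z ω + t) P ∧
    ∫ ω, 12 * (s + 8 * X ω + 2 * Y ω) + 12 * Z ω + t ∂P
      = 12 * (s + 8 * (∫ ω, X ω ∂P) + 2 * ∫ ω, Y ω ∂P) + 12 * (∫ ω, Z ω ∂P) + t := by
  have iX : Integrable (fun ω => s + 8 * X ω) P := (integrable_const s).add (hX.const_mul 8)
  have iY : Integrable (fun ω => s + 8 * X ω + 2 * Y ω) P := iX.add (hY.const_mul 2)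
  have iZ : Integrable (fun ω => 12 * (s + 8 * X ω + 2 * Y ω) + 12 * Z ω) P :=
    (iY.const_mul 12).add (hZ.const_mul 12)
  refine ⟨iZ.add (integrable_const t), ?_⟩
  rw [integral_add iZ (integrable_const t), integral_add (iY.const_mul 12) (hZ.const_mul 12),
    integral_const_mul, integral_const_mul, integral_add iX (hY.const_mul 2),
    integral_add (integrable_const s) (hX.const_mul 8), integral_const_mul, integral_const_mul]
  simp

/-- The expectation of the polynomial bound in terms of elementary quantities. -/
lemma integral_deviationBound_le [NeZero d₂] (hlaw : ∀ i, HasLaw (ξ i) (pairLaw d₁ d₂) P)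
    (hind : iIndepFun ξ P) (hW : ∀ c, W.col c ⬝ᵥ W.col c = 1)
    (hW' : ∀ c, W'.col c ⬝ᵥ W'.col c = 1) {K₂ K₃ : ℝ} (hK₂0 : 0 ≤ K₂)
    (hK₂ : ∀ (w w' u : Fin d₁ → ℝ), w ⬝ᵥ w = 1 → w' ⬝ᵥ w' = 1 →
      ∫ x, (sign (x ⬝ᵥ w) - sign (x ⬝ᵥ w')) ^ 2 * (x ⬝ᵥ u) ^ 2 ∂gaussianPi d₁
        ≤ K₂ * √((w - w') ⬝ᵥ (w - w')) * (u ⬝ᵥ u))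
    (hK₃ : ∀ (w w' : Fin d₁ → ℝ), w ⬝ᵥ w = 1 → w' ⬝ᵥ w' = 1 →
      ∫ x, (sign (x ⬝ᵥ w) - sign (x ⬝ᵥ w')) ^ 2 * (x ⬝ᵥ x - d₁) ^ 2 ∂gaussianPi d₁
        ≤ K₃ * d₁ * √((w - w') ⬝ᵥ (w - w'))) {β : Matrix (Fin d₁) (Fin d₂) ℝ}
    (hβ : ∀ a j, ∫ p, gapEntry W W' a j p ∂pairLaw d₁ d₂ = β a j) :
    Integrable (fun ω => deviationBound W W' β fun i => ξ i ω) P ∧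
    ∫ ω, deviationBound W W' β (fun i => ξ i ω) ∂P ≤
      12 * (32 * (d₁ : ℝ) ^ 2 + 8 * (m * (K₃ * d₁ * (∑ c, colDist W W' c) / d₂))
        + 2 * ∑ j, (m : ℝ) ^ 2 * (K₂ * d₁ * colDist W W' j / d₂) ^ 2)
      + 12 * (2 * (m : ℝ) ^ 2 * (2 * (d₁ * (K₂ * ((∑ c, colDist W W' c) / d₂)) ^ 2)
        + 2 * (∑ a, ∑ j, β a j ^ 2) ^ 2))
      + 108 * (m : ℝ) ^ 2 * (∑ a, ∑ j, β a j ^ 2) ^ 2 := by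
  have := isProbabilityMeasure_uniformOn_univ (d₂ := d₂)
  have mF : HasAllMoments (gapFluctuation W W') (pairLaw d₁ d₂) :=
    hasAllMoments_pairLaw hasAllMoments_gapFluctuation_slice
  have mT (j : Fin d₂) : HasAllMoments (gapWeight W W' j) (pairLaw d₁ d₂) :=
    hasAllMoments_pairLaw (hasAllMoments_gapWeight_slice j)
  have iF (i : Fin m) : Integrable (fun ω => gapFluctuation W W' (ξ i ω)) P :=
    (mF.comp_hasLaw (hlaw i)).integrable
  have iFs : Integrable (fun ω => ∑ i, gapFluctuation W W' (ξ i ω)) P :=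
    integrable_finsetSum _ fun i _ => iF i
  have hFs : ∫ ω, ∑ i, gapFluctuation W W' (ξ i ω) ∂P
      ≤ m * (K₃ * d₁ * (∑ c, colDist W W' c) / d₂) := by
    rw [integral_finsetSum _ fun i _ => iF i]
    have e (i : Fin m) : ∫ ω, gapFluctuation W W' (ξ i ω) ∂P
        = ∫ p, gapFluctuation W W' p ∂pairLaw d₁ d₂ :=
      (hlaw i).integral_comp measurable_gapFluctuation.aestronglyMeasurable
    simp only [e, Finset.sum_const, Finset.card_univ, Fintype.card_fin, nsmul_eq_mul]
    exact mul_le_mul_of_nonneg_left (integral_gapFluctuation_le hW hW' hK₃) (Nat.cast_nonneg _)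
  have iT (j : Fin d₂) (q : Fin m × Fin m) : Integrable (fun ω =>
      gapWeight W W' j (ξ q.1 ω) * gapWeight W W' j (ξ q.2 ω)) P :=
    (((mT j).comp_hasLaw (hlaw q.1)).mul ((mT j).comp_hasLaw (hlaw q.2))).integrable
  have iTs : Integrable (fun ω => ∑ j, ∑ q ∈ Finset.univ.offDiag,
      gapWeight W W' j (ξ q.1 ω) * gapWeight W W' j (ξ q.2 ω)) P :=
    integrable_finsetSum _ fun j _ => integrable_finsetSum _ fun q _ => iT j q
  have hTs : ∫ ω, ∑ j, ∑ q ∈ Finset.univ.offDiag,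
      gapWeight W W' j (ξ q.1 ω) * gapWeight W W' j (ξ q.2 ω) ∂P
      ≤ ∑ j, (m : ℝ) ^ 2 * (K₂ * d₁ * colDist W W' j / d₂) ^ 2 := by
    rw [integral_finsetSum _ fun j _ => integrable_finsetSum _ fun q _ => iT j q]
    refine Finset.sum_le_sum fun j _ => ?_
    rw [integral_finsetSum _ fun q _ => iT j q]
    have h0 : 0 ≤ ∫ p, gapWeight W W' j p ∂pairLaw d₁ d₂ := integral_nonneg fun p => by
      simp only [gapWeight]
      split_ifs
      · exact mul_nonneg (sq_nonneg _) (dotProduct_self_nonneg_real _)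
      · exact le_rfl
    have e (q : Fin m × Fin m) (hq : q ∈ Finset.univ.offDiag) :
        ∫ ω, gapWeight W W' j (ξ q.1 ω) * gapWeight W W' j (ξ q.2 ω) ∂P
          ≤ (K₂ * d₁ * colDist W W' j / d₂) ^ 2 := by
      have hne : q.1 ≠ q.2 := by simpa using hq
      have hi := (hind.indepFun hne).integral_fun_comp_mul_comp (f := gapWeight W W' j)
        (g := gapWeight W W' j) (hlaw _).aemeasurable (hlaw _).aemeasurable
        (measurable_gapWeight j).aestronglyMeasurable (measurable_gapWeight j).aestronglyMeasurable
      have hl (i : Fin m) : ∫ ω, gapWeight W W' j (ξ i ω) ∂P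
          = ∫ p, gapWeight W W' j p ∂pairLaw d₁ d₂ :=
        (hlaw i).integral_comp (measurable_gapWeight j).aestronglyMeasurable
      rw [hi, hl, hl, ← sq]
      exact pow_le_pow_left₀ h0 (integral_gapWeight_le hW hW' hK₂ j) 2
    refine (Finset.sum_le_sum e).trans ?_
    rw [Finset.sum_const, nsmul_eq_mul]
    refine mul_le_mul_of_nonneg_right ?_ (sq_nonneg _)
    rw [Finset.offDiag_card, sq]
    exact_mod_cast (Nat.sub_le _ _).trans (by simp)
  obtain ⟨iH, hH⟩ := integral_sum_sq_gram_offDiag_le hlaw hind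
    (f := fun a j p => gapEntry W W' a j p - β a j)
    (fun a j => (measurable_gapEntry a j).sub_const _)
    (fun a j => (hasAllMoments_gapEntry a j).sub (.const _))
    (fun a j => by
      rw [integral_sub (hasAllMoments_gapEntry a j).integrable (integrable_const _), hβ]
      simp)
  have hcov := sum_sq_covariance_gapEntry_le hW hW' hK₂0 hK₂ hβ
  have hH' := hH.trans (mul_le_mul_of_nonneg_left hcov (by positivity))
  obtain ⟨hi, he⟩ := integrable_and_integral_affine iFs iTs iH (32 * (d₁ : ℝ) ^ 2)
    (108 * (m : ℝ) ^ 2 * (∑ a, ∑ j, β a j ^ 2) ^ 2)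
  refine ⟨hi, (le_of_eq he).trans ?_⟩
  gcongr

/-- The expectation of the polynomial bound, up to a universal constant. -/
lemma exists_integral_deviationBound_le : ∃ K : ℝ, 0 < K ∧
    ∀ {d₁ d₂ m : ℕ} [NeZero d₂] {W W' : Matrix (Fin d₁) (Fin d₂) ℝ} {Ω : Type*}
      [MeasurableSpace Ω] {P : Measure Ω} [IsProbabilityMeasure P]
      {ξ : Fin m → Ω → (Fin d₁ → ℝ) × Fin d₂}, (∀ i, HasLaw (ξ i) (pairLaw d₁ d₂) P) →
      iIndepFun ξ P → (∀ c, W.col c ⬝ᵥ W.col c = 1) → (∀ c, W'.col c ⬝ᵥ W'.col c = 1) →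
      d₂ < d₁ →
      Integrable (fun ω => deviationBound W W' ((√(2 / Real.pi) / d₂) • (W - W'))
        fun i => ξ i ω) P ∧
      ∫ ω, deviationBound W W' ((√(2 / Real.pi) / d₂) • (W - W')) (fun i => ξ i ω) ∂P ≤
        K * (d₁ : ℝ) ^ 2 * (1 + (m / d₂ : ℝ) ^ 2 * ∑ a, ∑ c, (W - W') a c ^ 2) := by
  obtain ⟨K₂, hK₂0, hK₂⟩ := exists_integral_sq_sign_sub_sign_mul_sq_le
  obtain ⟨K₃, hK₃0, hK₃⟩ := exists_integral_sq_sign_sub_sign_mul_normSq_sub_sq_le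
  -- `1008 = 12 · 32 + 4 (48 + 108)` collects the deterministic and mean terms, `96 = 12 · 8` the
  -- fluctuations, and `72 = 24 + 48` the pair products and the covariance.
  refine ⟨1008 + 96 * K₃ + 72 * K₂ ^ 2, by positivity, ?_⟩
  intro d₁ d₂ m _ W W' Ω _ P _ ξ hlaw hind hW hW' hd
  have hβ (a : Fin d₁) (j : Fin d₂) : ∫ p, gapEntry W W' a j p ∂pairLaw d₁ d₂
      = ((√(2 / Real.pi) / d₂) • (W - W')) a j := by
    rw [integral_gapEntry hW hW']
    simp
  obtain ⟨h1, h2⟩ := integral_deviationBound_le hlaw hind hW hW' hK₂0.le (hK₂ d₁) (hK₃ d₁) hβ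
  refine ⟨h1, h2.trans ?_⟩
  have hd2 : (1 : ℝ) ≤ d₂ := by exact_mod_cast NeZero.one_le
  have hd12 : (d₂ : ℝ) ≤ d₁ := by exact_mod_cast hd.le
  have hβs : ∑ a, ∑ j, ((√(2 / Real.pi) / d₂) • (W - W')) a j ^ 2
      = (2 / Real.pi) / (d₂ : ℝ) ^ 2 * ∑ a, ∑ c, (W - W') a c ^ 2 := by
    simp only [Matrix.smul_apply, smul_eq_mul, mul_pow, ← Finset.mul_sum, div_pow]
    rw [Real.sq_sqrt (by positivity)]
  have hF4 : ∑ a, ∑ c, (W - W') a c ^ 2 ≤ 4 * d₂ := by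
    rw [← sum_sq_colDist]
    refine (Finset.sum_le_sum fun c _ => sq_colDist_le hW hW' c).trans (le_of_eq ?_)
    simp [mul_comm]
  have hcs : (∑ c, colDist W W' c) ^ 2 ≤ d₂ * ∑ a, ∑ c, (W - W') a c ^ 2 := by
    rw [← sum_sq_colDist]
    simpa using sq_sum_le_card_mul_sum_sq (s := Finset.univ) (f := colDist W W')
  have hsum : ∑ j, (m : ℝ) ^ 2 * (K₂ * d₁ * colDist W W' j / d₂) ^ 2
      = K₂ ^ 2 * (d₁ : ℝ) ^ 2 * ((m / d₂ : ℝ) ^ 2 * ∑ a, ∑ c, (W - W') a c ^ 2) := by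
    rw [← sum_sq_colDist, Finset.mul_sum, Finset.mul_sum]
    exact Finset.sum_congr rfl fun c _ => by ring
  have hF0 : 0 ≤ ∑ a, ∑ c, (W - W') a c ^ 2 :=
    Finset.sum_nonneg fun a _ => Finset.sum_nonneg fun c _ => sq_nonneg _
  rw [hβs, hsum]
  generalize ∑ a, ∑ c, (W - W') a c ^ 2 = F at *
  generalize ∑ c, colDist W W' c = σ at *
  set ρ : ℝ := m / d₂ with hρ
  have hρ0 : 0 ≤ ρ := by positivity
  set q := ρ ^ 2 * F with hq
  have hq0 : 0 ≤ q := by positivity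
  -- Cauchy-Schwarz over columns gives `σ² ≤ d₂ F`; the assumption on the dimensions replaces `d₂`
  -- by `d₁`.
  have hσ2 : (ρ * σ) ^ 2 ≤ d₁ * q := by
    rw [mul_pow, hq]
    nlinarith [mul_le_mul_of_nonneg_left hcs (sq_nonneg ρ),
      mul_le_mul_of_nonneg_right hd12 hq0]
  have hd1 : (1 : ℝ) ≤ d₁ := hd2.trans hd12
  have hσ : ρ * σ ≤ d₁ * (1 + q) := by
    refine le_of_abs_le (abs_le_of_sq_le_sq ?_ (by positivity))
    nlinarith [mul_nonneg (by linarith : (0 : ℝ) ≤ d₁ - 1) hq0, sq_nonneg (1 - q),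
      mul_nonneg (by positivity : (0 : ℝ) ≤ (d₁ : ℝ) ^ 2) (by positivity : 0 ≤ 1 + q ^ 2),
      mul_nonneg (by positivity : (0 : ℝ) ≤ (d₁ : ℝ)) hq0]
  -- The crude bound `F ≤ 4 d₂` for unit columns turns one of the two factors `F` into a constant.
  have hβ4 : (m : ℝ) ^ 2 * (2 / Real.pi / (d₂ : ℝ) ^ 2 * F) ^ 2 ≤ 4 * q := by
    have hpi : 2 / Real.pi ≤ 1 := by
      rw [div_le_one Real.pi_pos]; linarith [Real.pi_gt_three]
    have hpi0 : 0 ≤ 2 / Real.pi := by positivity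
    have e : (m : ℝ) ^ 2 * (2 / Real.pi / (d₂ : ℝ) ^ 2 * F) ^ 2
        = (2 / Real.pi) ^ 2 * q * (F / (d₂ : ℝ) ^ 2) := by
      rw [hq, hρ]
      field_simp
    have hF' : F / (d₂ : ℝ) ^ 2 ≤ 4 := by
      rw [div_le_iff₀ (by positivity)]
      nlinarith
    rw [e]
    calc _ ≤ 1 ^ 2 * q * 4 := by gcongr
      _ = _ := by ring
  have e1 : (m : ℝ) * (K₃ * d₁ * σ / d₂) = K₃ * d₁ * (ρ * σ) := by rw [hρ]; ring
  have e2 : 12 * (2 * (m : ℝ) ^ 2 * (2 * (d₁ * (K₂ * (σ / d₂)) ^ 2)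
      + 2 * (2 / Real.pi / (d₂ : ℝ) ^ 2 * F) ^ 2))
      = 48 * (d₁ * K₂ ^ 2 * (ρ * σ) ^ 2)
        + 48 * ((m : ℝ) ^ 2 * (2 / Real.pi / (d₂ : ℝ) ^ 2 * F) ^ 2) := by rw [hρ]; ring
  have hd1sq : 1 ≤ (d₁ : ℝ) ^ 2 := one_le_pow₀ hd1
  have b1 : K₃ * d₁ * (ρ * σ) ≤ K₃ * d₁ * (d₁ * (1 + q)) := by gcongr
  have b2 : d₁ * K₂ ^ 2 * (ρ * σ) ^ 2 ≤ d₁ * K₂ ^ 2 * (d₁ * q) := by gcongr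
  have b3 : q ≤ (d₁ : ℝ) ^ 2 * q := le_mul_of_one_le_left hq0 hd1sq
  rw [e1, e2]
  have b4 : 0 ≤ K₂ ^ 2 * (d₁ : ℝ) ^ 2 := by positivity
  have b5 : 0 ≤ (d₁ : ℝ) ^ 2 * q := by positivity
  nlinarith

end Deviation

/-! ### Rescaling, rank and choice of the sample size. -/

section Final

variable {d₁ d₂ m : ℕ}

lemma sign_mul_of_pos {s : ℝ} (hs : 0 < s) (t : ℝ) : sign (s * t) = sign t := by
  unfold sign
  simp only [mul_nonneg_iff_of_pos_left hs]

lemma sensing_apply (x : Fin m → Fin d₁ → ℝ) (j : Fin m → Fin d₂)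
    (W : Matrix (Fin d₁) (Fin d₂) ℝ) (i : Fin m) :
    sensing x j W i = √(d₂ : ℝ) * (x i ⬝ᵥ W.col (j i)) := by
  simp only [sensing, inner, sensingMatrix, scaledOneHot, Matrix.vecMulVec_apply, Pi.smul_apply,
    smul_eq_mul, dotProduct, Matrix.col, Finset.mul_sum]
  refine Finset.sum_congr rfl fun a _ => ?_
  rw [Finset.sum_eq_single (j i)]
  · simp [Matrix.transpose_apply]
    ring
  · intro b _ hb
    simp [hb]
  · simp

lemma sensingMatrix_eq (x : Fin d₁ → ℝ) (j : Fin d₂) :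
    sensingMatrix x j = √(d₂ : ℝ) • Matrix.vecMulVec x (Pi.single j 1) := by
  ext a b
  simp [sensingMatrix, scaledOneHot, Matrix.vecMulVec_apply]
  ring

/-- The factor `√d₂` inside a measurement does not affect its sign; the one in the sensing matrix
combines with that of the estimator to `d₂`. -/
lemma estimator_sub_eq [NeZero d₂] (hm : 1 ≤ m) (x : Fin m → Fin d₁ → ℝ) (j : Fin m → Fin d₂)
    (W W' : Matrix (Fin d₁) (Fin d₂) ℝ) :
    (√(d₂ : ℝ) / (√(2 / Real.pi) * m)) •
        (sensingAdjoint x j (fun i => sign (sensing x j W i)) -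
          sensingAdjoint x j (fun i => sign (sensing x j W' i))) - (W - W')
      = (d₂ / (√(2 / Real.pi) * m) : ℝ) • (∑ i, gapMatrix W W' (x i, j i)
          - (m : ℝ) • ((√(2 / Real.pi) / d₂) • (W - W'))) := by
  have hd : (0 : ℝ) < d₂ := by exact_mod_cast NeZero.pos d₂
  have hm' : (m : ℝ) ≠ 0 := by positivity
  have hl : √(2 / Real.pi) ≠ 0 := (Real.sqrt_pos.2 (by positivity)).ne'
  have h1 : sensingAdjoint x j (fun i => sign (sensing x j W i)) -
      sensingAdjoint x j (fun i => sign (sensing x j W' i))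
      = √(d₂ : ℝ) • ∑ i, gapMatrix W W' (x i, j i) := by
    simp only [sensingAdjoint, ← Finset.sum_sub_distrib, ← sub_smul, Finset.smul_sum]
    refine Finset.sum_congr rfl fun i _ => ?_
    rw [sensing_apply, sensing_apply, sign_mul_of_pos (Real.sqrt_pos.2 hd),
      sign_mul_of_pos (Real.sqrt_pos.2 hd), sensingMatrix_eq, smul_comm]
    rw [gapMatrix, Matrix.smul_vecMulVec]
    rfl
  rw [h1, smul_sub, smul_smul, smul_smul, smul_smul, div_mul_eq_mul_div, Real.mul_self_sqrt hd.le]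
  congr 1
  rw [show (d₂ / (√(2 / Real.pi) * m) : ℝ) * m * (√(2 / Real.pi) / d₂) = 1 by field_simp,
    one_smul]

lemma IsSample.hasLaw_pair {Ω : Type*} [MeasurableSpace Ω] {P : Measure Ω}
    [IsProbabilityMeasure P] {x : Fin m → Ω → Fin d₁ → ℝ} {j : Fin m → Ω → Fin d₂}
    (h : IsSample P x j) (i : Fin m) :
    HasLaw (fun ω => (x i ω, j i ω)) (pairLaw d₁ d₂) P :=
  (h.indep_pair i).hasLaw_prod (h.law_x i) (h.law_j i)

lemma col_dotProduct_self_of_mem {k : ℕ} {W : Matrix (Fin d₁) (Fin d₂) ℝ}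
    (hW : W ∈ normalizedRankLE d₁ d₂ k) (c : Fin d₂) : W.col c ⬝ᵥ W.col c = 1 := by
  have h := hW.2 c
  rw [EuclideanSpace.norm_eq, Real.sqrt_eq_one] at h
  simpa [dotProduct, Matrix.col, sq] using h

lemma one_le_of_mem_normalizedRankLE [NeZero d₂] {k : ℕ} {W : Matrix (Fin d₁) (Fin d₂) ℝ}
    (hW : W ∈ normalizedRankLE d₁ d₂ k) : 1 ≤ k := by
  by_contra hk
  have h0 : W.rank = 0 := by have := hW.1; omega
  have h1 := sum_sq_le_rank_mul_sq_l2_opNorm W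
  rw [h0, Nat.cast_zero, zero_mul, ← sub_zero W, ← sum_sq_colDist] at h1
  have h2 := Finset.single_le_sum (fun c _ => sq_nonneg (colDist W 0 c)) (Finset.mem_univ (0 : Fin d₂))
  have h3 : colDist W 0 0 ^ 2 = 1 := by
    rw [colDist, Real.sq_sqrt (dotProduct_self_nonneg_real _)]
    have : (0 : Matrix (Fin d₁) (Fin d₂) ℝ).col 0 = 0 := rfl
    rw [this, sub_zero]
    exact col_dotProduct_self_of_mem hW 0
  linarith

/-- Subadditivity of rank gives `2 * k`; this is the only quantitative use of low rank. -/
lemma sum_sq_sub_le {k : ℕ} {W W' : Matrix (Fin d₁) (Fin d₂) ℝ}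
    (hW : W ∈ normalizedRankLE d₁ d₂ k) (hW' : W' ∈ normalizedRankLE d₁ d₂ k) :
    ∑ a, ∑ c, (W - W') a c ^ 2 ≤ 2 * k * ‖W - W'‖ ^ 2 := by
  refine (sum_sq_le_rank_mul_sq_l2_opNorm (W - W')).trans ?_
  gcongr
  have h1 : (W - W').rank ≤ W.rank + W'.rank := by
    unfold Matrix.rank
    refine (Submodule.finrank_mono ?_).trans (Submodule.finrank_add_le_finrank_add_finrank
      (LinearMap.range W.mulVecLin) (LinearMap.range W'.mulVecLin))
    rintro _ ⟨v, rfl⟩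
    rw [Matrix.mulVecLin_apply, Matrix.sub_mulVec]
    exact sub_mem (Submodule.mem_sup_left ⟨v, rfl⟩) (Submodule.mem_sup_right ⟨v, rfl⟩)
  have := hW.1
  have := hW'.1
  have h3 : (W - W').rank ≤ 2 * k := by omega
  exact_mod_cast h3

/-- Markov's inequality in the form of a lower bound for the probability of the good event. -/
lemma one_sub_le_measureReal_of_integral_le {Ω : Type*} [MeasurableSpace Ω] {P : Measure Ω}
    [IsProbabilityMeasure P] {V : Ω → ℝ} (hV : Integrable V P) (hV0 : ∀ ω, 0 ≤ V ω) {ε η : ℝ}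
    (hε : 0 < ε) (h : ∫ ω, V ω ∂P ≤ η * ε) {s : Set Ω} (hs : ∀ ω, ω ∉ s → ε ≤ V ω) :
    1 - η ≤ P.real s := by
  have h1 := mul_meas_ge_le_integral_of_nonneg (Filter.Eventually.of_forall hV0) hV ε
  have h2 : P.real {ω | ε ≤ V ω} ≤ η := by
    refine le_of_mul_le_mul_left ?_ hε
    linarith
  have h3 : P.real (Set.univ : Set Ω) ≤ P.real s + P.real {ω | ε ≤ V ω} := by
    refine (measureReal_mono ?_).trans (measureReal_union_le _ _)
    intro ω _
    by_cases hω : ω ∈ s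
    · exact Or.inl hω
    · exact Or.inr (hs ω hω)
  rw [probReal_univ] at h3
  linarith

/-- The choice of the constant. -/
lemma moment_le_of_sample_size {K l η C C' d k ρ δ z : ℝ} (hK : 0 < K)
    (hl : 0 < l) (hη : 0 < η) (hC' : 0 < C') (hd : 1 ≤ d) (hk : 1 ≤ k)
    (hδ : 0 < δ) (hC : C = (4 * K / (η * l ^ 4) + 1) * (1 + C'))
    (hρ : C * d * √k / δ ^ 2 ≤ ρ) (hz : 0 ≤ z) :
    K * d ^ 2 * (1 + ρ ^ 2 * (2 * k * z ^ 2))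
      ≤ η * (l * ρ * (δ * max z (max (√z) (δ / (C' * √d * √k))))) ^ 4 := by
  -- `L` pays for the moment constant and the failure probability. Since `L ≥ 1`, its powers may be
  -- inserted freely, and `C = L (1 + C')` dominates both `L` and `L C'`.
  set L := 4 * K / (η * l ^ 4) + 1 with hL
  have hL1 : 1 ≤ L := by rw [hL]; linarith [show 0 ≤ 4 * K / (η * l ^ 4) by positivity]
  have hL0 : 0 < L := by linarith
  have hLK : 2 * K ≤ η * l ^ 4 / 2 * L := by
    have : η * l ^ 4 / 2 * L = 2 * K + η * l ^ 4 / 2 := by rw [hL]; field_simp; ring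
    rw [this]
    have : 0 ≤ η * l ^ 4 / 2 := by positivity
    linarith
  have hCL : L ≤ C := by rw [hC]; nlinarith
  have hCL' : L * C' ≤ C := by rw [hC]; nlinarith
  have hsk : 0 < √k := Real.sqrt_pos.2 (by linarith)
  have hsd : 0 < √d := Real.sqrt_pos.2 (by linarith)
  have hρδ : C * d * √k ≤ ρ * δ ^ 2 := by rwa [div_le_iff₀ (by positivity)] at hρ
  have hC0 : 0 < C := by linarith
  have hρ0 : 0 < ρ := lt_of_lt_of_le (by positivity) hρ
  set δ' := δ / (C' * √d * √k) with hδ'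
  have hδ'0 : 0 < δ' := by positivity
  set M := max z (max (√z) δ') with hM
  have hMz : √z ≤ M := (le_max_left _ _).trans (le_max_right _ _)
  have hMδ : δ' ≤ M := (le_max_right _ _).trans (le_max_right _ _)
  have hM0 : 0 < M := hδ'0.trans_le hMδ
  -- The floor `δ'` is calibrated so that the part of the moment independent of `z` fits under the
  -- threshold.
  have h1 : L * √d ≤ ρ * (δ * δ') := by
    rw [hδ', show ρ * (δ * (δ / (C' * √d * √k))) = ρ * δ ^ 2 / (C' * √d * √k) by ring,
      le_div_iff₀ (by positivity)]
    calc L * √d * (C' * √d * √k) = L * C' * (√d * √d) * √k := by ring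
      _ = L * C' * d * √k := by rw [Real.mul_self_sqrt (by linarith)]
      _ ≤ C * d * √k := by gcongr
      _ ≤ _ := hρδ
  have h2 : L * d ^ 2 ≤ (ρ * (δ * M)) ^ 4 := by
    calc L * d ^ 2 ≤ L ^ 4 * d ^ 2 := by gcongr; exact le_self_pow₀ hL1 (by norm_num)
      _ = (L * √d) ^ 4 := by
          rw [mul_pow, show √d ^ 4 = (√d ^ 2) ^ 2 by ring, Real.sq_sqrt (by linarith)]
      _ ≤ (ρ * (δ * M)) ^ 4 := by
          refine pow_le_pow_left₀ (by positivity) (h1.trans ?_) 4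
          gcongr
  -- Here `√z ≤ M` enters, as `z² ≤ M⁴`; two of the four factors `ρ` absorb `d² k`.
  have h3 : L * d ^ 2 * (ρ ^ 2 * (k * z ^ 2)) ≤ (ρ * (δ * M)) ^ 4 := by
    have hz4 : z ^ 2 ≤ M ^ 4 := by
      have := pow_le_pow_left₀ (Real.sqrt_nonneg z) hMz 4
      rwa [show √z ^ 4 = (√z ^ 2) ^ 2 by ring, Real.sq_sqrt hz] at this
    calc L * d ^ 2 * (ρ ^ 2 * (k * z ^ 2)) ≤ L ^ 2 * d ^ 2 * (ρ ^ 2 * (k * z ^ 2)) := by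
          gcongr; exact le_self_pow₀ hL1 (by norm_num)
      _ ≤ C ^ 2 * d ^ 2 * (ρ ^ 2 * (k * z ^ 2)) := by gcongr
      _ = (C * d * √k) ^ 2 * (ρ ^ 2 * z ^ 2) := by
          rw [mul_pow _ (√k), Real.sq_sqrt (by linarith)]; ring
      _ ≤ (ρ * δ ^ 2) ^ 2 * (ρ ^ 2 * M ^ 4) := by gcongr
      _ = _ := by ring
  have h4 : K * d ^ 2 * (1 + ρ ^ 2 * (2 * k * z ^ 2))
      ≤ 2 * K * (d ^ 2 * (1 + ρ ^ 2 * (k * z ^ 2))) := by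
    have : 0 ≤ K * d ^ 2 := by positivity
    nlinarith
  calc _ ≤ 2 * K * (d ^ 2 * (1 + ρ ^ 2 * (k * z ^ 2))) := h4
    _ ≤ η * l ^ 4 / 2 * L * (d ^ 2 * (1 + ρ ^ 2 * (k * z ^ 2))) := by gcongr
    _ = η * l ^ 4 / 2 * (L * d ^ 2 + L * d ^ 2 * (ρ ^ 2 * (k * z ^ 2))) := by ring
    _ ≤ η * l ^ 4 / 2 * ((ρ * (δ * M)) ^ 4 + (ρ * (δ * M)) ^ 4) := by gcongr
    _ = _ := by ring

end Final

end OneBitSensing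

theorem theorem2 (η : ℝ) (hη : η ∈ Set.Ioo (0 : ℝ) 1) (C' : ℝ) (hC' : 0 < C') :
    ∃ C : ℝ, 0 < C ∧
      ∀ (d₁ d₂ k m : ℕ) (δ δ' : ℝ) (W W' : Matrix (Fin d₁) (Fin d₂) ℝ)
        (Ω : Type*) [MeasurableSpace Ω] (P : Measure Ω) [IsProbabilityMeasure P]
        (x : Fin m → Ω → Fin d₁ → ℝ) (j : Fin m → Ω → Fin d₂),
        OneBitSensing.IsSample P x j →
        d₂ < d₁ →
        W ∈ OneBitSensing.normalizedRankLE d₁ d₂ k →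
        W' ∈ OneBitSensing.normalizedRankLE d₁ d₂ k →
        W ≠ W' →
        0 < δ →
        C * d₁ * d₂ * √(k : ℝ) / δ ^ 2 ≤ (m : ℝ) →
        δ' = δ / (C' * √(d₁ : ℝ) * √(k : ℝ)) →
        1 - η ≤ P.real {ω |
          ‖(√(d₂ : ℝ) / (√(2 / Real.pi) * m)) •
              (OneBitSensing.sensingAdjoint (fun i => x i ω) (fun i => j i ω)
                  (fun i => OneBitSensing.sign
                    (OneBitSensing.sensing (fun i => x i ω) (fun i => j i ω) W i)) -
                OneBitSensing.sensingAdjoint (fun i => x i ω) (fun i => j i ω)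
                  (fun i => OneBitSensing.sign
                    (OneBitSensing.sensing (fun i => x i ω) (fun i => j i ω) W' i))) -
              (W - W')‖
            ≤ δ * max ‖W - W'‖ (max (√‖W - W'‖) δ')} := by
  obtain ⟨K, hK, hmain⟩ := OneBitSensing.exists_integral_deviationBound_le
  have hl : 0 < √(2 / Real.pi) := Real.sqrt_pos.2 (by positivity)
  have hη0 := hη.1
  refine ⟨(4 * K / (η * √(2 / Real.pi) ^ 4) + 1) * (1 + C'), by positivity, ?_⟩
  intro d₁ d₂ k m δ δ' W W' Ω _ P _ x j hS hd hW hW' hne hδ hm hδ'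
  -- Without columns all matrices coincide, so distinctness forces `d₂ > 0`.
  have hd2 : d₂ ≠ 0 := by
    rintro rfl
    exact hne (Subsingleton.elim _ _)
  have : NeZero d₂ := ⟨hd2⟩
  have hd2' : (0 : ℝ) < d₂ := by exact_mod_cast NeZero.pos d₂
  have hk : 1 ≤ k := OneBitSensing.one_le_of_mem_normalizedRankLE hW
  have hd1 : 1 ≤ d₁ := by omega
  have hk' : (1 : ℝ) ≤ k := by exact_mod_cast hk
  have hd1' : (1 : ℝ) ≤ d₁ := by exact_mod_cast hd1
  have hmpos : (0 : ℝ) < m := lt_of_lt_of_le (by positivity) hm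
  have hm1 : 1 ≤ m := by exact_mod_cast hmpos
  obtain ⟨hint, hexp⟩ := hmain (ξ := fun i ω => (x i ω, j i ω)) hS.hasLaw_pair hS.indep
    (OneBitSensing.col_dotProduct_self_of_mem hW) (OneBitSensing.col_dotProduct_self_of_mem hW') hd
  have hρ : (4 * K / (η * √(2 / Real.pi) ^ 4) + 1) * (1 + C') * d₁ * √(k : ℝ) / δ ^ 2
      ≤ (m : ℝ) / d₂ := by
    rw [le_div_iff₀ hd2']
    refine le_trans (le_of_eq ?_) hm
    ring
  have hconst := OneBitSensing.moment_le_of_sample_size hK hl hη0 hC' hd1' hk' hδ rfl hρ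
    (norm_nonneg (W - W'))
  rw [← hδ'] at hconst
  have hδ'0 : 0 < δ' := by rw [hδ']; positivity
  set M := max ‖W - W'‖ (max (√‖W - W'‖) δ') with hM
  have hM0 : 0 < M := hδ'0.trans_le ((le_max_right _ _).trans (le_max_right _ _))
  have hdev := fun ω => OneBitSensing.l2_opNorm_pow_four_le_deviationBound W W' hm1
    ((√(2 / Real.pi) / d₂) • (W - W')) fun i => (x i ω, j i ω)
  refine OneBitSensing.one_sub_le_measureReal_of_integral_le hint
    (fun ω => (by positivity : (0 : ℝ) ≤ _ ^ 4).trans (hdev ω))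
    -- The threshold `δ M` for the estimator error, multiplied by `λ m / d₂` to undo the scaling and
    -- raised to the fourth power.
    (ε := (√(2 / Real.pi) * (m / d₂) * (δ * M)) ^ 4) (by positivity) ?_ fun ω hω => ?_
  · refine hexp.trans (le_trans ?_ hconst)
    gcongr
    exact OneBitSensing.sum_sq_sub_le hW hW'
  · refine le_trans ?_ (hdev ω)
    rw [Set.mem_ofPred_eq, not_le, OneBitSensing.estimator_sub_eq hm1, norm_smul,
      Real.norm_of_nonneg (by positivity)] at hω
    gcongr
    calc √(2 / Real.pi) * (m / d₂) * (δ * M)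
        ≤ √(2 / Real.pi) * (m / d₂) * (d₂ / (√(2 / Real.pi) * m) *
          ‖∑ i, OneBitSensing.gapMatrix W W' (x i ω, j i ω)
            - (m : ℝ) • ((√(2 / Real.pi) / d₂) • (W - W'))‖) := by gcongr
      _ = _ := by field_simp
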